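/- Let $p$ be a prime, $\mathbf F_q$ a finite field of characteristic $p$, and $f\in\mathbf F_q[x]=\mathbf F_q[x_1,\dots,x_n]$ a polynomial of degree $\delta$; write $f^{(j)}$ for its homogeneous part of degree $j$. Let $1\le\delta'\le\delta-1$ be such that $f^{(j)}=0$ for $\delta'<j<\delta$, i.e. $f=f^{(\delta)}+f^{(\delta')}+f^{(\delta'-1)}+\cdots+f^{(0)}$. Let $\Omega^k=\Omega^k_{\mathbf F_q[x]/\mathbf F_q}$ be the module of differential $k$-forms and let $\phi_f:\Omega^k\to\Omega^{k+1}$ be $\phi_f(\omega)=df\wedge\omega$. A form $\omega=\sum_{i_1<\cdots<i_k}\omega(i_1,\dots,i_k)\,dx_{i_1}\wedge\cdots\wedge dx_{i_k}$ is called homogeneous with $\deg_{\rm coeff}\omega=l$ if every coefficient $\omega(i_1,\dots,i_k)$ is a homogeneous polynomial of degree $l$ (or zero); put then $\deg\omega=l+(n-k)(\delta-1)$. Let $F_l\Omega^k$ be the $\mathbf F_q$-span of the homogeneous $k$-forms $\omega$ with $\deg\omega\le l$. This is an increasing filtration of the complex $(\Omega^{\cdot},\phi_f)$; let $E_e^{r,s}$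 denote the terms of its spectral sequence $$E_1^{r,s}=H^{r+s}(F_r/F_{r-1}(\Omega^{\cdot},\phi_f))\Rightarrow H^{r+s}(\Omega^{\cdot},\phi_f).$$ Explicitly, $E_e^{r,s}=Z_e^r/(Z_{e-1}^{r-1}+\phi_f Z_{e-1}^{r+e-1})$ in form degree $r+s$, where $Z_e^r$ consists of the $\omega\in F_r$ with $\phi_f(\omega)\in F_{r-e}$. Suppose that $f^{(\delta)}=f_1^{a_1}\cdots f_t^{a_t}$, where the $f_i\in\mathbf F_q[x]$ are homogeneous of positive degree and the following hold. - For every subset $\{i_1,\dots,i_k\}\subseteq\{1,\dots,t\}$ the system $f_{i_1}=\cdots=f_{i_k}=0$ defines a smooth complete intersection of codimension $k$ in $\mathbf P^{n-1}$. - If either $k\ge2$, or $k=1$ and $a_{i_1}>1$, then the system $f^{(\delta')}=f_{i_1}=\cdots=f_{i_k}=0$ defines a smooth complete intersection of codimension $k+1$ in $\mathbf P^{n-1}$. - $p$ is prime to $\delta\delta'a_1\cdots a_t$. (A system $g_1=\cdots=g_c=0$ of forms defines a smooth complete intersection of codimension $c$ in $\mathbf P^{n-1}$ if at each common zero of the $g_i$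 in $\mathbf P^{n-1}$ over an algebraic closure of $\mathbf F_q$ their gradients are linearly independent; for $c\ge n$ this means that there is no common zero.) Then, for $e=\delta-\delta'+1$, $$E_e^{r,s}=0\qquad\text{for all integers } r,s \text{ with } r+s\ne n.$$ Equivalently (and also asserted): let $k<n$ and let $\omega\in\Omega^k$ be a homogeneous form such that $df^{(\delta)}\wedge\omega=0$ and $df^{(\delta')}\wedge\omega=df^{(\delta)}\wedge\xi$ for some homogeneous form $\xi\in\Omega^k$. Then there exist homogeneous forms $\eta_1,\eta_2\in\Omega^{k-1}$ with $df^{(\delta)}\wedge\eta_1=0$ and $$\omega=df^{(\delta')}\wedge\eta_1+df^{(\delta)}\wedge\eta_2.$$ -/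

import Mathlib

noncomputable section

namespace PolyForms

/-! ### Spectral sequence of an increasing filtration

`d : M →ₗ[F] M` is the differential of a cochain complex all of whose terms live in `M`, and
`Fil r k` is the `r`-th step (increasing in `r`) of the filtration on the term of degree `k`. -/

section SpectralSequence

variable {F M : Type*} [Field F] [AddCommGroup M] [Module F M]

/-- The approximate cycles `Z_e^{r}` in degree `k`: elements of `F_r K^k` whose differential lies
in `F_{r-e} K^{k+1}`. -/
def approxCycles (d : M →ₗ[F] M) (Fil : ℤ → ℤ → Submodule F M) (e r k : ℤ) : Submodule F M :=
  Fil r k ⊓ (Fil (r - e) (k + 1)).comap d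

/-- The approximate boundaries `Z_{e-1}^{r-1} + d Z_{e-1}^{r+e-1}` in degree `k`. -/
def approxBoundaries (d : M →ₗ[F] M) (Fil : ℤ → ℤ → Submodule F M) (e r k : ℤ) :
    Submodule F M :=
  approxCycles d Fil (e - 1) (r - 1) k ⊔ (approxCycles d Fil (e - 1) (r + e - 1) (k - 1)).map d

/-- The term `E_e^{r,s} = Z_e^r / (Z_{e-1}^{r-1} + d Z_{e-1}^{r+e-1})`, in total degree `r + s`,
of the spectral sequence of the filtered complex.  For `e = 1` it is `H^{r+s}(F_r / F_{r-1})`. -/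
abbrev pageTerm (d : M →ₗ[F] M) (Fil : ℤ → ℤ → Submodule F M) (e r s : ℤ) : Type _ :=
  ↥(approxCycles d Fil e r (r + s)) ⧸
    (approxBoundaries d Fil e r (r + s)).comap (approxCycles d Fil e r (r + s)).subtype

end SpectralSequence

/-! ### Differential forms on affine space -/

section Forms

variable (F : Type*) [Field F] (n : ℕ)

/-- The algebra `Ω^•` of differential forms of `F[x₁, …, xₙ]` over `F`: the exterior algebra
over `F[x₁, …, xₙ]` of the module of Kähler differentials. -/
abbrev Forms : Type _ :=
  ExteriorAlgebra (MvPolynomial (Fin n) F) (KaehlerDifferential F (MvPolynomial (Fin n) F))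

variable {F n}

/-- The exterior derivative `df`, as a `1`-form. -/
def dform (f : MvPolynomial (Fin n) F) : Forms F n :=
  ExteriorAlgebra.ι (MvPolynomial (Fin n) F)
    (KaehlerDifferential.D F (MvPolynomial (Fin n) F) f)

/-- The differential `φ_f : ω ↦ df ∧ ω`. -/
def wedgeD (f : MvPolynomial (Fin n) F) : Forms F n →ₗ[F] Forms F n :=
  LinearMap.mulLeft F (dform f)

variable (F n)

/-- The homogeneous `k`-forms `ω` with `deg_coeff ω = m`: the sums of forms
`g dx_{i₁} ∧ ⋯ ∧ dx_{i_k}` with `i₁ < ⋯ < i_k` and `g` a homogeneous polynomial of degree `m`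
(or `0`).  The form degree is an integer; there are no nonzero forms in negative degree. -/
def homForms (k : ℤ) (m : ℕ) : Submodule F (Forms F n) :=
  Submodule.span F {ω | ∃ (j : ℕ) (i : Fin j ↪o Fin n) (g : MvPolynomial (Fin n) F),
    (j : ℤ) = k ∧ g.IsHomogeneous m ∧
      ω = g • ExteriorAlgebra.ιMulti (MvPolynomial (Fin n) F) j
        (fun t => KaehlerDifferential.D F (MvPolynomial (Fin n) F) (MvPolynomial.X (i t)))}

/-- `F_l Ω^k`: the `F`-span of the homogeneous `k`-forms `ω` with
`deg ω = deg_coeff ω + (n - k)(δ - 1) ≤ l`. -/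
def degFiltration (δ : ℕ) (l k : ℤ) : Submodule F (Forms F n) :=
  Submodule.span F {ω | ∃ m : ℕ, ω ∈ homForms F n k m ∧
    (m : ℤ) + ((n : ℤ) - k) * ((δ : ℤ) - 1) ≤ l}

end Forms

/-! ### Smooth complete intersections -/

/-- The forms `g i` (homogeneous of positive degree), `i ∈ ι`, define a smooth complete
intersection of codimension `#ι` in `ℙ^{n-1}` over the field `F`: at every geometric point of
`ℙ^{n-1}` where all `g i` vanish their differentials are linearly independent (Jacobian
criterion).  If `#ι ≥ n` this says, by Euler's relation, that the common zero locus in `ℙ^{n-1}`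
is empty; if `#ι < n` that locus is never empty. -/
def IsSmoothCompleteIntersection {F : Type*} [Field F] {n : ℕ} {ι : Type*}
    (g : ι → MvPolynomial (Fin n) F) : Prop :=
  (∀ i, ∃ d : ℕ, 0 < d ∧ (g i).IsHomogeneous d) ∧
  ∀ x : Fin n → AlgebraicClosure F, x ≠ 0 → (∀ i, MvPolynomial.aeval x (g i) = 0) →
    LinearIndependent (AlgebraicClosure F)
      (fun i => fun j => MvPolynomial.aeval x (MvPolynomial.pderiv j (g i)))

end PolyForms

end

/-! Write R = F[x], Φ = f^(δ) = ∏ g_i^{a_i} and G = f^(δ'). The degree of forms is normalised so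
that dΦ∧ preserves it and dG∧ lowers it by δ - δ'. Both assertions thereby reduce to one exactness
statement, `IsAdmissible.mem_of_mul_mem`: on the cohomology H of (Ω, dΦ∧), multiplication by dG is
exact in form degrees below n.

This exactness follows from an acyclicity lemma in the style of Peskine and Szpiro,
`acyclic_of_awayFromOrigin`: a complex whose k-th term has projective dimension at most k, and whose
homology is supported at the origin, is exact below degree n. The reason is that a module of
projective dimension less than n has no nonzero element supported at the origin (`eq_zero_of_pdLT`).
Two inputs are needed.

Support: at a point other than the origin, smoothness yields a vector field that either has nonzero
derivative on Φ there, so that its contraction kills H locally, or annihilates Φ but not G, so that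
its contraction is a homotopy for dG∧ on H (`exists_vectorField`, `exists_smul_mem_of_mul_mem`).

Projective dimension: let K^k be the k-forms killed by dΦ. Contraction θ with the Euler field gives
δω = (dΦ/Φ)∧θω on K^k, and θω is ∏ g_i times a form with logarithmic poles. Away from the origin
logarithmic forms are generated by wedging with the dx_j and the dg_i/g_i. Hence K^k is the quotient
of the (k-1)-st exterior power of V ⊕ R^t, V being the module of 1-forms, by the ideal of the
vectors dg_i - g_i e_i and ∑ a_i e_i (`logMap_eq_zero_iff`, `kerDeg_eq_map`). These vectors are
independent at every point but the origin, so repeated use of the acyclicity lemma bounds the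
projective dimension of K^k by k - 1 (`pdLT_extDeg_quotient`). The bound for H follows from
dΦ∧Ω^{k-1} ≅ Ω^{k-1}/K^{k-1}.

Exterior degrees are shifted by one throughout, so that index 0 is the zero module and the condition
at index k reads "projective dimension < k". -/

noncomputable section

namespace PolyForms

universe u

section

open CategoryTheory Abelian

/-! ### Projective dimension and vanishing of Ext -/

section Homological

variable {R : Type u} [CommRing R]

/-- `M` has projective dimension `< d`. -/
abbrev PdLT (R : Type u) [CommRing R] (M : Type u) [AddCommGroup M] [Module R M] (d : ℕ) : Prop :=
  HasProjectiveDimensionLT (ModuleCat.of R M) d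

variable {M N P : Type u} [AddCommGroup M] [Module R M] [AddCommGroup N] [Module R N]
  [AddCommGroup P] [Module R P]

lemma PdLT.of_equiv (e : M ≃ₗ[R] N) {d : ℕ} (h : PdLT R M d) : PdLT R N d :=
  haveI := h
  hasProjectiveDimensionLT_of_iso e.toModuleIso d

lemma PdLT.mono {d e : ℕ} (h : PdLT R M d) (hde : d ≤ e) : PdLT R M e :=
  haveI := h
  hasProjectiveDimensionLT_of_ge _ d e hde

lemma PdLT.of_subsingleton [Subsingleton M] (d : ℕ) : PdLT R M d :=
  PdLT.mono (d := 0) ((ModuleCat.isZero_of_subsingleton _).hasProjectiveDimensionLT_zero)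
    (Nat.zero_le _)

lemma PdLT.of_free [Module.Free R M] {d : ℕ} (hd : 1 ≤ d) : PdLT R M d :=
  PdLT.mono (d := 1) inferInstance hd

lemma PdLT.of_exact {f : M →ₗ[R] N} {g : N →ₗ[R] P} (hf : Function.Injective f)
    (hg : Function.Surjective g) (hfg : Function.Exact f g) {d : ℕ} (h₁ : PdLT R M d)
    (h₂ : PdLT R N (d + 1)) : PdLT R P (d + 1) := by
  let S : ShortComplex (ModuleCat.{u} R) :=
    ShortComplex.mk (ModuleCat.ofHom f) (ModuleCat.ofHom g) (by
      ext x; exact hfg.apply_apply_eq_zero x)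
  have hS : S.ShortExact :=
    { exact := (ShortComplex.ShortExact.moduleCat_exact_iff_function_exact S).2 hfg
      mono_f := (ModuleCat.mono_iff_injective _).2 hf
      epi_g := (ModuleCat.epi_iff_surjective _).2 hg }
  exact hS.hasProjectiveDimensionLT_X₃ d h₁ h₂

/-- Rees: a weakly regular sequence on R in I stays so on a free module, and a coordinate of a basis
vector shows I • M ≠ M, so the grade of I on M bounds the vanishing range. -/
lemma subsingleton_ext_of_free [IsNoetherianRing R] {I : Ideal R} (hI : I ≠ ⊤) {rs : List R}
    (hmem : ∀ r ∈ rs, r ∈ I) (hreg : RingTheory.Sequence.IsWeaklyRegular R rs)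
    (N : ModuleCat.{u} R) [Module.Finite R N]
    (hN : Module.support R N ⊆ PrimeSpectrum.zeroLocus I) (M : ModuleCat.{u} R)
    [Module.Finite R M] [Module.Free R M] {i : ℕ} (hi : i < rs.length) :
    Subsingleton (Ext N M i) := by
  rcases subsingleton_or_nontrivial M with hM | hM
  · have h0 := ModuleCat.isZero_of_subsingleton M
    refine ⟨fun a b => ?_⟩
    rw [← a.comp_mk₀_id, ← b.comp_mk₀_id, h0.eq_of_src (𝟙 M) 0, Ext.mk₀_zero, Ext.comp_zero,
      Ext.comp_zero]
  · have hlt : I • (⊤ : Submodule R M) < ⊤ := by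
      rw [lt_top_iff_ne_top]
      intro htop
      let b := Module.Free.chooseBasis R M
      obtain ⟨j⟩ := b.index_nonempty
      have h1 : b j ∈ I • (⊤ : Submodule R M) := by rw [htop]; exact Submodule.mem_top
      have h2 : b.coord j (b j) ∈ I := by
        have h3 := Submodule.mem_map_of_mem (f := b.coord j) h1
        rw [Submodule.map_smul''] at h3
        exact (Submodule.smul_le.2 fun r hr m _ => I.mul_mem_right m hr) h3
      refine hI (I.eq_top_iff_one.2 ?_)
      simpa using h2
    have hwr : RingTheory.Sequence.IsWeaklyRegular M rs :=
      ((TensorProduct.lid R M).isWeaklyRegular_congr rs).1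
        hreg.isWeaklyRegular_rTensor
    refine ModuleCat.subsingleton_ext_of_exists_isRegular I N hN M hlt rs hmem ⟨hwr, ?_⟩ i hi
    intro h
    have : (Ideal.ofList rs • ⊤ : Submodule R M) ≤ I • ⊤ :=
      Submodule.smul_mono_left (Ideal.span_le.2 hmem)
    exact hlt.ne (top_le_iff.1 (h.le.trans this))

/-- Dimension shifting: the kernel K of a finite free cover Q → M has projective dimension one less,
and Ext^i(N, M) sits between Ext^i(N, Q) and Ext^{i+1}(N, K). A projective M is a summand of Q. -/
lemma subsingleton_ext_of_pdLT [IsNoetherianRing R] {I : Ideal R} (hI : I ≠ ⊤) {rs : List R}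
    (hmem : ∀ r ∈ rs, r ∈ I) (hreg : RingTheory.Sequence.IsWeaklyRegular R rs)
    (N : ModuleCat.{u} R) [Module.Finite R N]
    (hN : Module.support R N ⊆ PrimeSpectrum.zeroLocus I) (d : ℕ) (M : ModuleCat.{u} R)
    [Module.Finite R M] (hM : HasProjectiveDimensionLT M (d + 1)) {i : ℕ}
    (hi : d + i < rs.length) : Subsingleton (Ext N M i) := by
  induction d generalizing M i with
  | zero =>
    obtain ⟨Q, _, _, _, _, q, hq⟩ := Module.exists_finite_presentation R M
    have : Projective M := projective_iff_hasProjectiveDimensionLT_one.2 hM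
    have : Module.Projective R M := (IsProjective.iff_projective M).2 this
    obtain ⟨s, hs⟩ := Module.projective_lifting_property q LinearMap.id hq
    have hQ : Subsingleton (Ext N (ModuleCat.of R Q) i) :=
      subsingleton_ext_of_free hI hmem hreg N hN (ModuleCat.of R Q) (by omega)
    have hid : ModuleCat.ofHom s ≫ ModuleCat.ofHom q = 𝟙 M := by
      ext x; exact LinearMap.congr_fun hs x
    have key (a : Ext N M i) : a = 0 := by
      rw [← a.comp_mk₀_id, ← hid, ← Ext.mk₀_comp_mk₀,
        ← Ext.comp_assoc_of_third_deg_zero,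
        Subsingleton.elim (a.comp (Ext.mk₀ (ModuleCat.ofHom s)) (add_zero i)) 0, Ext.zero_comp]
    exact ⟨fun a b => (key a).trans (key b).symm⟩
  | succ d ih =>
    obtain ⟨Q, _, _, _, _, q, hq⟩ := Module.exists_finite_presentation R M
    let S : ShortComplex (ModuleCat.{u} R) := q.shortComplexKer
    have hS : S.ShortExact := LinearMap.shortExact_shortComplexKer hq
    have hQ : Subsingleton (Ext N S.X₂ i) :=
      subsingleton_ext_of_free hI hmem hreg N hN (ModuleCat.of R Q) (by omega)
    have h1 : HasProjectiveDimensionLT S.X₁ (d + 1) :=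
      hS.hasProjectiveDimensionLT_X₁ (d + 1)
        (PdLT.of_free (R := R) (M := Q) (by omega)) hM
    have : Module.Finite R S.X₁ := inferInstanceAs (Module.Finite R (LinearMap.ker q))
    have hK : Subsingleton (Ext N S.X₁ (i + 1)) := ih S.X₁ h1 (by omega)
    have zero1 := AddCommGrpCat.isZero_of_iff_subsingleton.mpr hQ
    have zero2 := AddCommGrpCat.isZero_of_iff_subsingleton.mpr hK
    exact AddCommGrpCat.subsingleton_of_isZero <| ShortComplex.Exact.isZero_of_both_zeros
        ((Ext.covariant_sequence_exact₃' N hS) i (i + 1) rfl)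
        (zero1.eq_zero_of_src _) (zero2.eq_zero_of_tgt _)

end Homological

/-! ### Elements supported at the origin -/

section Torsion

variable {F : Type u} [Field F] {n : ℕ}

lemma isWeaklyRegular_X (F : Type u) [Field F] (n : ℕ) :
    RingTheory.Sequence.IsWeaklyRegular (MvPolynomial (Fin n) F)
      ((List.finRange n).map fun i => (MvPolynomial.X i : MvPolynomial (Fin n) F)) := by
  refine ⟨fun i hi => ?_⟩
  have hi' : i < n := by simpa using hi
  have hspan : (Ideal.ofList (((List.finRange n).map
      fun i => (MvPolynomial.X i : MvPolynomial (Fin n) F)).take i) • ⊤ :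
      Submodule (MvPolynomial (Fin n) F) (MvPolynomial (Fin n) F)) =
      Ideal.span (MvPolynomial.X '' {j : Fin n | (j : ℕ) < i}) := by
    rw [smul_eq_mul, Ideal.mul_top, Ideal.ofList]
    congr 1
    ext p
    simp only [← List.map_take, List.mem_map, Set.mem_image, Set.mem_ofPred_eq]
    refine exists_congr fun j => and_congr_left fun _ => ?_
    rw [List.mem_take_iff_getElem]
    constructor
    · rintro ⟨m, hm, rfl⟩
      simp at hm ⊢
      omega
    · intro hj
      exact ⟨j, by simp; omega, by simp⟩
  rw [hspan]
  rw [isSMulRegular_quotient_iff_mem_of_smul_mem]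
  intro p hp
  simp only [List.getElem_map, List.getElem_finRange, smul_eq_mul] at hp
  change MvPolynomial.X (⟨i, hi'⟩ : Fin n) * p ∈ _ at hp
  rw [MvPolynomial.mem_ideal_span_X_image] at hp ⊢
  intro m hm
  obtain ⟨j, hj, hne⟩ := hp (m + Finsupp.single ⟨i, hi'⟩ 1) (by
    rw [MvPolynomial.mem_support_iff] at hm ⊢
    rw [add_comm, MvPolynomial.coeff_X_mul]
    exact hm)
  refine ⟨j, hj, ?_⟩
  have : (⟨i, hi'⟩ : Fin n) ≠ j := by
    rintro rfl
    simp at hj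
  simpa [Finsupp.single_apply, this] using hne

/-- `P` holds after multiplication by some polynomial not vanishing at `x`, for every geometric
point `x` other than the origin. -/
def AwayFromOrigin (P : MvPolynomial (Fin n) F → Prop) : Prop :=
  ∀ x : Fin n → AlgebraicClosure F, x ≠ 0 → ∃ s, MvPolynomial.aeval x s ≠ 0 ∧ P s

/-- Nullstellensatz: the zero locus of I is contained in the origin. -/
lemma X_mem_radical {I : Ideal (MvPolynomial (Fin n) F)} (h : AwayFromOrigin (· ∈ I))
    (i : Fin n) : (MvPolynomial.X i : MvPolynomial (Fin n) F) ∈ I.radical := by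
  rw [← MvPolynomial.vanishingIdeal_zeroLocus_eq_radical (K := AlgebraicClosure F)]
  intro x hx
  have hx0 : x = 0 := by
    by_contra hne
    obtain ⟨s, hs, hsI⟩ := h x hne
    exact hs (hx s hsI)
  simp [hx0]

/-- The cyclic module N = Rv is supported at the origin, the variables form a regular sequence of
length n, and the projective dimension of M is at most n - 1; so Ext^0(N, M) = Hom(N, M) = 0 and the
inclusion of N vanishes. -/
lemma eq_zero_of_pdLT {M : Type u} [AddCommGroup M] [Module (MvPolynomial (Fin n) F) M]
    [Module.Finite (MvPolynomial (Fin n) F) M] (hM : PdLT (MvPolynomial (Fin n) F) M n) {v : M}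
    (hv : AwayFromOrigin fun s : MvPolynomial (Fin n) F => s • v = 0) : v = 0 := by
  rcases n with _ | d
  · have := isZero_of_hasProjectiveDimensionLT_zero (X := ModuleCat.of (MvPolynomial (Fin 0) F) M)
    have : Subsingleton M := ModuleCat.subsingleton_of_isZero this
    exact Subsingleton.elim _ _
  let R := MvPolynomial (Fin (d + 1)) F
  let I : Ideal R := Ideal.span (Set.range MvPolynomial.X)
  have hI : I ≠ ⊤ := by
    rw [Ne, Ideal.eq_top_iff_one]
    change 1 ∉ Ideal.span (Set.range MvPolynomial.X)
    rw [← Set.image_univ, MvPolynomial.mem_ideal_span_X_image]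
    intro h
    obtain ⟨i, -, hi⟩ := h 0 (by simp)
    simp at hi
  let N : Submodule R M := Submodule.span R {v}
  have hN : Module.support R (ModuleCat.of R N) ⊆ PrimeSpectrum.zeroLocus I := by
    rw [Module.support_eq_zeroLocus, PrimeSpectrum.zeroLocus_subset_zeroLocus_iff, Ideal.span_le]
    rintro _ ⟨i, rfl⟩
    refine X_mem_radical (fun x hx => ?_) i
    obtain ⟨s, hs, hsv⟩ := hv x hx
    refine ⟨s, hs, ?_⟩
    change s ∈ Module.annihilator R N
    rw [Submodule.mem_annihilator_span_singleton]
    exact hsv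
  have hsub := subsingleton_ext_of_pdLT hI (rs := (List.finRange (d + 1)).map
    fun i => (MvPolynomial.X i : R)) (by
      intro r hr
      obtain ⟨i, -, rfl⟩ := List.mem_map.1 hr
      exact Ideal.subset_span ⟨i, rfl⟩) (isWeaklyRegular_X F (d + 1)) (ModuleCat.of R N) hN d
      (ModuleCat.of R M) hM (i := 0) (by simp)
  have hsub' : Subsingleton (N →ₗ[R] M) :=
    ((Ext.addEquiv₀.trans ModuleCat.homAddEquiv).symm.subsingleton :
      Subsingleton (ModuleCat.of R N →ₗ[R] ModuleCat.of R M))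
  exact LinearMap.congr_fun (Subsingleton.elim N.subtype 0) ⟨v, Submodule.mem_span_singleton_self v⟩

/-- The local-to-global principle used everywhere below: membership may be tested away from the
origin once the quotient has projective dimension less than n. -/
lemma mem_of_pdLT_quotient {M : Type u} [AddCommGroup M] [Module (MvPolynomial (Fin n) F) M]
    [Module.Finite (MvPolynomial (Fin n) F) M] {X Y : Submodule (MvPolynomial (Fin n) F) M}
    (h : PdLT (MvPolynomial (Fin n) F) (X ⧸ Y.submoduleOf X) n) {v : M} (hvX : v ∈ X)
    (hv : AwayFromOrigin fun s : MvPolynomial (Fin n) F => s • v ∈ Y) : v ∈ Y := by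
  have h0 : (Y.submoduleOf X).mkQ ⟨v, hvX⟩ = 0 := by
    refine eq_zero_of_pdLT h fun x hx => ?_
    obtain ⟨s, hs, hsv⟩ := hv x hx
    refine ⟨s, hs, ?_⟩
    change s • (Y.submoduleOf X).mkQ ⟨v, hvX⟩ = 0
    rw [← map_smul]
    exact (Submodule.Quotient.mk_eq_zero (Y.submoduleOf X)).2 hsv
  exact (Submodule.Quotient.mk_eq_zero (Y.submoduleOf X)).1 h0

end Torsion

/-! ### Projective dimension of subquotients -/

section Subquotients

variable {R : Type u} [CommRing R] {M N : Type u} [AddCommGroup M] [Module R M]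
  [AddCommGroup N] [Module R N]

lemma PdLT.of_subquotients {X Y B : Submodule R M} (hYB : Y ≤ B) (hBX : B ≤ X) {d : ℕ}
    (h₁ : PdLT R (B ⧸ Y.submoduleOf B) d) (h₂ : PdLT R (X ⧸ Y.submoduleOf X) (d + 1)) :
    PdLT R (X ⧸ B.submoduleOf X) (d + 1) := by
  let f : (B ⧸ Y.submoduleOf B) →ₗ[R] (X ⧸ Y.submoduleOf X) :=
    Submodule.mapQ _ _ (Submodule.inclusion hBX) fun x hx => hx
  let g : (X ⧸ Y.submoduleOf X) →ₗ[R] (X ⧸ B.submoduleOf X) :=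
    Submodule.mapQ _ _ LinearMap.id fun x hx => hYB hx
  refine PdLT.of_exact (f := f) (g := g) ?_ ?_ ?_ h₁ h₂
  · rw [injective_iff_map_eq_zero]
    intro q
    induction q using Submodule.Quotient.induction_on with | _ b => ?_
    intro h
    exact (Submodule.Quotient.mk_eq_zero (Y.submoduleOf B)).2
      ((Submodule.Quotient.mk_eq_zero (Y.submoduleOf X)).1 h)
  · intro q
    induction q using Submodule.Quotient.induction_on with | _ b => ?_
    exact ⟨Submodule.Quotient.mk b, rfl⟩
  · intro q
    induction q using Submodule.Quotient.induction_on with | _ b => ?_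
    constructor
    · intro h
      have hb : (b : M) ∈ B := (Submodule.Quotient.mk_eq_zero (B.submoduleOf X)).1 h
      exact ⟨Submodule.Quotient.mk ⟨b, hb⟩, rfl⟩
    · rintro ⟨q', hq'⟩
      rw [← hq']
      induction q' using Submodule.Quotient.induction_on with | _ c => ?_
      exact (Submodule.Quotient.mk_eq_zero _).2 c.2

/-- A linear map `d` induces an isomorphism `X / B ≃ C / Y` if `C = d X + Y` and `B` is the
preimage of `Y` in `X`. -/
lemma PdLT.of_map {X B : Submodule R M} {C Y : Submodule R N} (d : M →ₗ[R] N)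
    (hC : C = X.map d ⊔ Y) (hB : ∀ v ∈ X, d v ∈ Y ↔ v ∈ B) {e : ℕ}
    (h : PdLT R (X ⧸ B.submoduleOf X) e) : PdLT R (C ⧸ Y.submoduleOf C) e := by
  have hdC : ∀ v ∈ X, d v ∈ C := fun v hv =>
    hC ▸ Submodule.mem_sup_left (Submodule.mem_map_of_mem hv)
  let φ : X →ₗ[R] (C ⧸ Y.submoduleOf C) :=
    (Y.submoduleOf C).mkQ ∘ₗ d.restrict hdC
  have hker : LinearMap.ker φ = B.submoduleOf X := by
    ext v
    rw [LinearMap.mem_ker]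
    change Submodule.Quotient.mk _ = _ ↔ _
    rw [Submodule.Quotient.mk_eq_zero]
    exact hB v v.2
  have hsurj : Function.Surjective φ := by
    intro q
    induction q using Submodule.Quotient.induction_on with | _ c => ?_
    obtain ⟨c, hc⟩ := c
    have hc' := hc
    rw [hC] at hc'
    obtain ⟨_, ⟨v, hv, rfl⟩, y, hy, rfl⟩ := Submodule.mem_sup.1 hc'
    refine ⟨⟨v, hv⟩, ?_⟩
    refine (Submodule.Quotient.eq _).2 ?_
    change d v - (d v + y) ∈ Y
    simpa using hy
  exact h.of_equiv ((Submodule.quotEquivOfEq _ _ hker.symm).trans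
    (φ.quotKerEquivOfSurjective hsurj))

end Subquotients

/-! ### The acyclicity lemma -/

section Acyclicity

variable {F : Type u} [Field F] {n : ℕ} {M : Type u} [AddCommGroup M]
  [Module (MvPolynomial (Fin n) F) M] [Module.Finite (MvPolynomial (Fin n) F) M]

/-- Acyclicity lemma: the complex of the subquotients `X k / Y k` of `M` with differential `d`,
whose homology is supported at the origin and whose `k`-th term has projective dimension `< k`,
is exact up to the spot `n`. -/
lemma acyclic_of_awayFromOrigin (d : M →ₗ[MvPolynomial (Fin n) F] M)
    (X Y : ℕ → Submodule (MvPolynomial (Fin n) F) M) (hX0 : X 0 = ⊥) (hYX : ∀ k, Y k ≤ X k)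
    (hdX : ∀ k, (X k).map d ≤ X (k + 1)) (hdY : ∀ k, (Y k).map d ≤ Y (k + 1))
    (hdd : ∀ k, ∀ v ∈ X k, d (d v) ∈ Y (k + 2))
    (hpd : ∀ k ≤ n, PdLT (MvPolynomial (Fin n) F) (X k ⧸ (Y k).submoduleOf (X k)) k)
    (htor : ∀ k, k + 1 ≤ n → ∀ v ∈ X (k + 1), d v ∈ Y (k + 2) →
      AwayFromOrigin fun s : MvPolynomial (Fin n) F => s • v ∈ (X k).map d ⊔ Y (k + 1))
    (k : ℕ) (hk : k + 1 ≤ n) :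
    (∀ v ∈ X (k + 1), d v ∈ Y (k + 2) → v ∈ (X k).map d ⊔ Y (k + 1)) ∧
    PdLT (MvPolynomial (Fin n) F)
      (X (k + 1) ⧸ ((X k).map d ⊔ Y (k + 1)).submoduleOf (X (k + 1))) (k + 1) := by
  have hBX (k) : (X k).map d ⊔ Y (k + 1) ≤ X (k + 1) := sup_le (hdX k) (hYX _)
  -- If the image of the differential has projective dimension < k, its cokernel has projective
  -- dimension < k + 1 ≤ n, so local exactness globalises.
  have main : ∀ k, k + 1 ≤ n → PdLT (MvPolynomial (Fin n) F)
      (((X k).map d ⊔ Y (k + 1) : Submodule _ M) ⧸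
        (Y (k + 1)).submoduleOf ((X k).map d ⊔ Y (k + 1))) k →
      (∀ v ∈ X (k + 1), d v ∈ Y (k + 2) → v ∈ (X k).map d ⊔ Y (k + 1)) ∧
      PdLT (MvPolynomial (Fin n) F)
        (X (k + 1) ⧸ ((X k).map d ⊔ Y (k + 1)).submoduleOf (X (k + 1))) (k + 1) := by
    intro k hk h
    have h2 := PdLT.of_subquotients le_sup_right (hBX k) h (hpd (k + 1) hk)
    exact ⟨fun v hv hdv => mem_of_pdLT_quotient (h2.mono hk) hv (htor k hk v hv hdv), h2⟩
  refine main k hk ?_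
  induction k with
  | zero =>
    refine PdLT.of_map (X := X 0) (B := ⊥) d rfl (fun v hv => ?_) ?_
    · rw [hX0, Submodule.mem_bot] at hv
      simp [hv]
    · have : Subsingleton (X 0) := by rw [hX0]; infer_instance
      have : Subsingleton (X 0 ⧸ (⊥ : Submodule _ M).submoduleOf (X 0)) :=
        (Submodule.mkQ_surjective _).subsingleton
      exact PdLT.of_subsingleton 0
  | succ k ih =>
    obtain ⟨hex, hpd'⟩ := main k (by omega) (ih (by omega))
    -- Exactness just proved identifies the next image with the cokernel, whose projective dimension
    -- is already bounded.
    refine PdLT.of_map (X := X (k + 1)) d rfl (fun v hv => ⟨hex v hv, fun h => ?_⟩) hpd'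
    obtain ⟨_, ⟨u, hu, rfl⟩, y, hy, rfl⟩ := Submodule.mem_sup.1 h
    rw [map_add]
    exact add_mem (hdd k u hu) (hdY _ (Submodule.mem_map_of_mem hy))

end Acyclicity

/-! ### Contraction and ideals of vectors in the exterior algebra -/

section Exterior

variable {R : Type*} [CommRing R] {W : Type*} [AddCommGroup W] [Module R W]

open ExteriorAlgebra (ι)

variable (R W) in
/-- The exterior powers, as submodules of the exterior algebra, with the grading shifted by one:
`extDeg (k + 1)` is the `k`-th exterior power and `extDeg 0 = 0`. -/
def extDeg : ℕ → Submodule R (ExteriorAlgebra R W)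
  | 0 => ⊥
  | k + 1 => ⋀[R]^k W

/-- Contraction with a linear form. -/
def contr (c : Module.Dual R W) : ExteriorAlgebra R W →ₗ[R] ExteriorAlgebra R W :=
  CliffordAlgebra.contractLeft (Q := (0 : QuadraticForm R W)) c

lemma contr_ι_mul (c : Module.Dual R W) (w : W) (η : ExteriorAlgebra R W) :
    contr c (ι R w * η) = c w • η - ι R w * contr c η :=
  CliffordAlgebra.contractLeft_ι_mul (Q := (0 : QuadraticForm R W)) c w η

lemma ι_mul_ι_mul_swap (u v : W) (η : ExteriorAlgebra R W) :
    ι R u * (ι R v * η) = -(ι R v * (ι R u * η)) := by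
  rw [← mul_assoc, ← mul_assoc, ← neg_mul, eq_neg_of_add_eq_zero_left
    (ExteriorAlgebra.ι_add_mul_swap u v)]

lemma ι_mul_ι_mul_self (u : W) (η : ExteriorAlgebra R W) : ι R u * (ι R u * η) = 0 := by
  rw [← mul_assoc, ExteriorAlgebra.ι_sq_zero, zero_mul]

lemma extDeg_induction {k : ℕ} {p : ExteriorAlgebra R W → Prop}
    (hadd : ∀ x y, p x → p y → p (x + y))
    (hmul : ∀ (w : W), ∀ η ∈ extDeg R W (k + 1), p (ι R w * η)) {η : ExteriorAlgebra R W}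
    (hη : η ∈ extDeg R W (k + 2)) : p η := by
  have h : η ∈ LinearMap.range (ι R (M := W)) * extDeg R W (k + 1) := by
    change η ∈ LinearMap.range (ι R (M := W)) * (LinearMap.range (ι R (M := W)) ^ k)
    rw [← pow_succ']
    exact hη
  induction h using Submodule.mul_induction_on' with
  | mem_mul_mem w hw ζ hζ => obtain ⟨w, rfl⟩ := hw; exact hmul w ζ hζ
  | add x _ y _ hx hy =>
    exact hadd _ _ (hx ((pow_succ' (LinearMap.range (ι R (M := W))) k).ge ‹_›))
      (hy ((pow_succ' (LinearMap.range (ι R (M := W))) k).ge ‹_›))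

lemma ι_mul_mem (w : W) {k : ℕ} {η : ExteriorAlgebra R W} (hη : η ∈ extDeg R W k) :
    ι R w * η ∈ extDeg R W (k + 1) := by
  cases k with
  | zero =>
    rw [extDeg, Submodule.mem_bot] at hη
    simp [hη]
  | succ k =>
    change ι R w * η ∈ LinearMap.range (ι R (M := W)) ^ (k + 1)
    rw [pow_succ']
    exact Submodule.mul_mem_mul ⟨w, rfl⟩ hη

lemma mem_extDeg_one {η : ExteriorAlgebra R W} (hη : η ∈ extDeg R W 1) :
    ∃ r : R, η = algebraMap R _ r := by
  change η ∈ LinearMap.range (ι R (M := W)) ^ 0 at hη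
  rw [pow_zero] at hη
  obtain ⟨r, hr⟩ := Submodule.mem_one.1 hη
  exact ⟨r, hr.symm⟩

lemma contr_mem (c : Module.Dual R W) {k : ℕ} {η : ExteriorAlgebra R W}
    (hη : η ∈ extDeg R W k) : contr c η ∈ extDeg R W (k - 1) := by
  match k with
  | 0 =>
    rw [extDeg, Submodule.mem_bot] at hη
    simp [hη]
  | 1 =>
    obtain ⟨r, rfl⟩ := mem_extDeg_one hη
    have : contr c (algebraMap R (ExteriorAlgebra R W) r) = 0 :=
      CliffordAlgebra.contractLeft_algebraMap (Q := (0 : QuadraticForm R W)) c r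
    rw [this]
    exact zero_mem _
  | k + 2 =>
    refine extDeg_induction (p := fun η => contr c η ∈ extDeg R W (k + 1))
      (fun x y hx hy => by rw [map_add]; exact add_mem hx hy) (fun w η hη => ?_) hη
    rw [contr_ι_mul]
    exact sub_mem (Submodule.smul_mem _ _ hη) (ι_mul_mem w (contr_mem c hη))

/-- The degree `k` part (in the shifted grading) of the ideal generated by the vectors in `l`. -/
def vecIdeal : List W → ℕ → Submodule R (ExteriorAlgebra R W)
  | [], _ => ⊥
  | u :: l, k => (extDeg R W (k - 1)).map (LinearMap.mulLeft R (ι R u)) ⊔ vecIdeal l k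

lemma mem_vecIdeal_cons {u : W} {l : List W} {k : ℕ} {η : ExteriorAlgebra R W} :
    η ∈ vecIdeal (R := R) (u :: l) k ↔
      ∃ ζ ∈ extDeg R W (k - 1), ∃ y ∈ vecIdeal (R := R) l k, ι R u * ζ + y = η := by
  rw [vecIdeal, Submodule.mem_sup]
  constructor
  · rintro ⟨_, ⟨ζ, hζ, rfl⟩, y, hy, rfl⟩
    exact ⟨ζ, hζ, y, hy, rfl⟩
  · rintro ⟨ζ, hζ, y, hy, rfl⟩
    exact ⟨_, ⟨ζ, hζ, rfl⟩, y, hy, rfl⟩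

lemma vecIdeal_le (l : List W) (k : ℕ) : vecIdeal l k ≤ extDeg R W k := by
  induction l with
  | nil => exact bot_le
  | cons u l ih =>
    refine sup_le ?_ ih
    rintro _ ⟨ζ, hζ, rfl⟩
    cases k with
    | zero =>
      rw [SetLike.mem_coe, extDeg, Submodule.mem_bot] at hζ
      simp [hζ]
    | succ k => exact ι_mul_mem u hζ

lemma vecIdeal_zero (l : List W) : vecIdeal (R := R) l 0 = ⊥ :=
  le_bot_iff.1 (vecIdeal_le l 0)

lemma ι_mul_mem_vecIdeal (w : W) {l : List W} {k : ℕ} {η : ExteriorAlgebra R W}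
    (hη : η ∈ vecIdeal l k) : ι R w * η ∈ vecIdeal l (k + 1) := by
  cases k with
  | zero =>
    rw [vecIdeal_zero, Submodule.mem_bot] at hη
    simp [hη]
  | succ k =>
    induction l generalizing η with
    | nil =>
      rw [vecIdeal, Submodule.mem_bot] at hη
      simp [hη]
    | cons u l ih =>
      obtain ⟨ζ, hζ, y, hy, rfl⟩ := mem_vecIdeal_cons.1 hη
      refine mem_vecIdeal_cons.2 ⟨-(ι R w * ζ), neg_mem (ι_mul_mem w hζ), _, ih hy, ?_⟩
      rw [mul_add, ι_mul_ι_mul_swap w u, mul_neg]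

lemma ι_mul_mem_vecIdeal_of_mem {w : W} {l : List W} (hw : w ∈ l) {k : ℕ}
    {η : ExteriorAlgebra R W} (hη : η ∈ extDeg R W k) : ι R w * η ∈ vecIdeal l (k + 1) := by
  induction l with
  | nil => simp at hw
  | cons u l ih =>
    rcases List.mem_cons.1 hw with rfl | hw
    · exact Submodule.mem_sup_left ⟨η, hη, rfl⟩
    · exact Submodule.mem_sup_right (ih hw)

/-- Contraction with c anticommutes with wedging by a vector that c kills. -/
lemma contr_mem_vecIdeal {c : Module.Dual R W} {l : List W} (hc : ∀ v ∈ l, c v = 0) {k : ℕ}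
    {η : ExteriorAlgebra R W} (hη : η ∈ vecIdeal l k) : contr c η ∈ vecIdeal l (k - 1) := by
  induction l generalizing η with
  | nil =>
    rw [vecIdeal, Submodule.mem_bot] at hη
    simp [hη]
  | cons u l ih =>
    obtain ⟨ζ, hζ, y, hy, rfl⟩ := mem_vecIdeal_cons.1 hη
    refine mem_vecIdeal_cons.2 ⟨-contr c ζ, neg_mem (contr_mem c hζ), _,
      ih (fun v hv => hc v (List.mem_cons_of_mem _ hv)) hy, ?_⟩
    rw [map_add, contr_ι_mul, hc u List.mem_cons_self, zero_smul, zero_sub, mul_neg]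

instance exteriorAlgebra_free [Module.Free R W] : Module.Free R (ExteriorAlgebra R W) := by
  classical
  have ⟨I, b⟩ := Module.Free.exists_basis R W
  let : LinearOrder I := linearOrderOfSTO WellOrderingRel
  exact Module.Free.of_basis b.ExteriorAlgebra

instance exteriorAlgebra_finite [Module.Free R W] [Module.Finite R W] :
    Module.Finite R (ExteriorAlgebra R W) := by
  classical
  let b := Module.Free.chooseBasis R W
  let : LinearOrder (Module.Free.ChooseBasisIndex R W) := linearOrderOfSTO WellOrderingRel
  exact Module.Finite.of_basis b.ExteriorAlgebra

lemma mem_extDeg_of_smul_mem [IsDomain R] [Module.Free R W] {r : R} (hr : r ≠ 0) {k : ℕ}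
    {η : ExteriorAlgebra R W} (h : r • η ∈ extDeg R W k) : η ∈ extDeg R W k := by
  cases k with
  | zero =>
    rw [extDeg, Submodule.mem_bot] at h ⊢
    exact (smul_eq_zero.1 h).resolve_left hr
  | succ k =>
    classical
    change η ∈ ⋀[R]^k W
    rw [← DirectSum.sum_support_decompose (fun i : ℕ => ⋀[R]^i W) η]
    refine sum_mem fun i _ => ?_
    rcases eq_or_ne i k with rfl | hik
    · exact (DirectSum.decompose (fun i : ℕ => ⋀[R]^i W) η i).2
    · have h1 := DirectSum.decompose_of_mem_ne (fun i : ℕ => ⋀[R]^i W) h hik.symm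
      rw [DirectSum.decompose_smul, DirectSum.smul_apply, Submodule.coe_smul] at h1
      rw [(smul_eq_zero.1 h1).resolve_left hr]
      exact zero_mem _

end Exterior

/-! ### Quotients of exterior powers by locally independent vectors -/

section Koszul

open ExteriorAlgebra (ι)

variable {F : Type u} [Field F] {n : ℕ} {W : Type u} [AddCommGroup W]
  [Module (MvPolynomial (Fin n) F) W]

/-- Each vector of the list `l` has, at the geometric point `x`, a linear form which does not
vanish on it and is zero on the later vectors of `l`. -/
def HasDualForms (x : Fin n → AlgebraicClosure F) : List W → Prop
  | [] => True
  | u :: l => (∃ c : Module.Dual (MvPolynomial (Fin n) F) W,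
      (∀ v ∈ l, c v = 0) ∧ MvPolynomial.aeval x (c u) ≠ 0) ∧ HasDualForms x l

variable [Module.Free (MvPolynomial (Fin n) F) W]

/-- The quotient by the ideal is torsion-free near x. If rη lies in the ideal of u :: l, then r(u∧η)
lies in that of l, so by induction s(u∧η) does for some s nonzero at x; contracting with the form
dual to u recovers s c(u) η modulo u. -/
lemma exists_smul_mem_vecIdeal {x : Fin n → AlgebraicClosure F} {l : List W}
    (hl : HasDualForms x l) {k : ℕ} {η : ExteriorAlgebra (MvPolynomial (Fin n) F) W}
    {r : MvPolynomial (Fin n) F} (hr : r ≠ 0) (hη : η ∈ extDeg (MvPolynomial (Fin n) F) W k)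
    (h : r • η ∈ vecIdeal l k) : ∃ s : MvPolynomial (Fin n) F,
      MvPolynomial.aeval x s ≠ 0 ∧ s • η ∈ vecIdeal l k := by
  induction l generalizing k η with
  | nil =>
    rw [vecIdeal, Submodule.mem_bot] at h
    refine ⟨1, by simp, ?_⟩
    rw [(smul_eq_zero.1 h).resolve_left hr]
    simp
  | cons u l ih =>
    obtain ⟨⟨c, hc, hcu⟩, hl'⟩ := hl
    obtain ⟨ζ, hζ, y, hy, hζy⟩ := mem_vecIdeal_cons.1 h
    have h1 : r • (ι (MvPolynomial (Fin n) F) u * η) ∈ vecIdeal l (k + 1) := by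
      rw [← mul_smul_comm, ← hζy, mul_add, ι_mul_ι_mul_self, zero_add]
      exact ι_mul_mem_vecIdeal u hy
    obtain ⟨s, hs, hsη⟩ := ih hl' (ι_mul_mem u hη) h1
    refine ⟨s * c u, by simpa using ⟨hs, hcu⟩, ?_⟩
    have h2 := contr_mem_vecIdeal hc hsη
    rw [map_smul, contr_ι_mul] at h2
    refine mem_vecIdeal_cons.2 ⟨s • contr c η, Submodule.smul_mem _ _ (contr_mem c hη), _, h2, ?_⟩
    rw [smul_sub, mul_smul, mul_smul_comm, add_sub_cancel]

variable [Module.Finite (MvPolynomial (Fin n) F) W]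

/-- Induction on the list: the quotient by u :: l is the cokernel of u∧ on the quotient by l. Since
c(u)η = u∧c(η) + c(u∧η), the dual form c of u makes this complex exact near every point but the
origin, and the acyclicity lemma applies. -/
lemma pdLT_extDeg_quotient {l : List W}
    (hl : ∀ x : Fin n → AlgebraicClosure F, x ≠ 0 → HasDualForms x l) (k : ℕ) (hk : k ≤ n) :
    PdLT (MvPolynomial (Fin n) F) (extDeg (MvPolynomial (Fin n) F) W k ⧸
      (vecIdeal l k).submoduleOf (extDeg (MvPolynomial (Fin n) F) W k)) k := by
  induction l generalizing k with
  | nil =>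
    cases k with
    | zero =>
      have : Subsingleton (extDeg (MvPolynomial (Fin n) F) W 0) := by
        rw [extDeg]; infer_instance
      have : Subsingleton (extDeg (MvPolynomial (Fin n) F) W 0 ⧸
          (vecIdeal [] 0).submoduleOf (extDeg (MvPolynomial (Fin n) F) W 0)) :=
        (Submodule.mkQ_surjective _).subsingleton
      exact PdLT.of_subsingleton 0
    | succ k =>
      have h1 : PdLT (MvPolynomial (Fin n) F) (extDeg (MvPolynomial (Fin n) F) W (k + 1))
          (k + 1) := by
        have : Module.Free (MvPolynomial (Fin n) F) (extDeg (MvPolynomial (Fin n) F) W (k + 1)) :=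
          inferInstanceAs (Module.Free _ (⋀[MvPolynomial (Fin n) F]^k W))
        exact PdLT.of_free (by omega)
      refine h1.of_equiv (Submodule.quotEquivOfEqBot _ ?_).symm
      rw [vecIdeal]
      exact Submodule.ker_subtype _
  | cons u l ih =>
    cases k with
    | zero =>
      have : Subsingleton (extDeg (MvPolynomial (Fin n) F) W 0) := by
        rw [extDeg]; infer_instance
      have : Subsingleton (extDeg (MvPolynomial (Fin n) F) W 0 ⧸
          (vecIdeal (u :: l) 0).submoduleOf (extDeg (MvPolynomial (Fin n) F) W 0)) :=
        (Submodule.mkQ_surjective _).subsingleton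
      exact PdLT.of_subsingleton 0
    | succ k =>
      refine (acyclic_of_awayFromOrigin
        (LinearMap.mulLeft (MvPolynomial (Fin n) F) (ι (MvPolynomial (Fin n) F) u))
        (extDeg (MvPolynomial (Fin n) F) W) (vecIdeal l) rfl (vecIdeal_le l) ?_ ?_ ?_
        (ih fun x hx => (hl x hx).2) ?_ k hk).2
      · rintro k _ ⟨η, hη, rfl⟩
        exact ι_mul_mem u hη
      · rintro k _ ⟨η, hη, rfl⟩
        exact ι_mul_mem_vecIdeal u hη
      · intro k v _
        rw [LinearMap.mulLeft_apply, LinearMap.mulLeft_apply, ι_mul_ι_mul_self]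
        exact zero_mem _
      · intro k _ η hη hd x hx
        obtain ⟨c, hc, hcu⟩ := (hl x hx).1
        refine ⟨c u, hcu, ?_⟩
        have h := contr_mem_vecIdeal hc hd
        rw [LinearMap.mulLeft_apply, contr_ι_mul] at h
        exact Submodule.mem_sup.2 ⟨_, ⟨contr c η, contr_mem c hη, rfl⟩, _, h, by simp⟩

end Koszul

/-! ### Dual linear forms from linear independence at a point -/

section DualForms

lemma exists_det_ne_zero {k ι κ : Type*} [Field k] [Fintype ι] [DecidableEq ι] [Fintype κ]
    {u : ι → κ → k} (hu : LinearIndependent k u) :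
    ∃ e : ι → κ, (Matrix.of fun i j => u i (e j)).det ≠ 0 := by
  have hrank : (Matrix.of u).rank = Fintype.card ι := LinearIndependent.rank_matrix hu
  rw [Matrix.rank_eq_finrank_span_cols] at hrank
  obtain ⟨f, hf, -, hind⟩ :=
    Submodule.exists_fun_fin_finrank_span_eq k (Set.range (Matrix.of u).col)
  choose e he using hf
  let σ : ι ≃ Fin (Module.finrank k (Submodule.span k (Set.range (Matrix.of u).col))) :=
    Fintype.equivFinOfCardEq hrank.symm
  refine ⟨fun i => e (σ i), ?_⟩
  have h2 : LinearIndependent k (fun i => f (σ i)) := hind.comp _ σ.injective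
  have h3 : (Matrix.of fun i j => u i (e (σ j))) = (Matrix.of fun i => f (σ i)).transpose := by
    ext i j
    exact congrFun (he (σ j)) i
  rw [h3, Matrix.det_transpose, ← isUnit_iff_ne_zero, ← Matrix.isUnit_iff_isUnit_det,
    ← Matrix.linearIndependent_rows_iff_isUnit]
  exact h2

variable {F : Type*} [Field F] {n : ℕ} {W : Type*} [AddCommGroup W]
  [Module (MvPolynomial (Fin n) F) W]

/-- Cramer's rule: take a maximal minor of the coordinates that is nonzero at x and replace its j-th
row by the coordinates of the argument. On the other vectors two rows coincide, so the form vanishes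
identically, not just at x. -/
lemma exists_dual_ne_zero {k ι κ : Type*} [Field k] [Algebra F k] [Fintype ι] [DecidableEq ι]
    [Fintype κ] (b : Module.Basis κ (MvPolynomial (Fin n) F) W) (x : Fin n → k) {v : ι → W}
    (hv : LinearIndependent k fun i j => MvPolynomial.aeval x (b.repr (v i) j)) (j : ι) :
    ∃ c : Module.Dual (MvPolynomial (Fin n) F) W,
      (∀ i, i ≠ j → c (v i) = 0) ∧ MvPolynomial.aeval x (c (v j)) ≠ 0 := by
  obtain ⟨e, he⟩ := exists_det_ne_zero hv
  let M : Matrix ι ι (MvPolynomial (Fin n) F) := Matrix.of fun i l => b.repr (v i) (e l)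
  let c : Module.Dual (MvPolynomial (Fin n) F) W :=
    (Matrix.detRowAlternating.toMultilinearMap.toLinearMap M j) ∘ₗ
      LinearMap.pi fun l => b.coord (e l)
  have hc (y : W) : c y = (M.updateRow j fun l => b.repr y (e l)).det := rfl
  refine ⟨c, fun i hij => ?_, ?_⟩
  · rw [hc]
    refine Matrix.det_zero_of_row_eq hij ?_
    rw [Matrix.updateRow_ne hij, Matrix.updateRow_self]
    rfl
  · have : (M.updateRow j fun l => b.repr (v j) (e l)) = M := Matrix.updateRow_eq_self M j
    rw [hc, this, AlgHom.map_det]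
    exact he

lemma hasDualForms_map {F W : Type u} [Field F] [AddCommGroup W]
    [Module (MvPolynomial (Fin n) F) W]
    {ι : Type*} {v : ι → W} {x : Fin n → AlgebraicClosure F}
    (h : ∀ j, ∃ c : Module.Dual (MvPolynomial (Fin n) F) W,
      (∀ i, i ≠ j → c (v i) = 0) ∧ MvPolynomial.aeval x (c (v j)) ≠ 0)
    {l : List ι} (hl : l.Nodup) : HasDualForms x (l.map v) := by
  induction l with
  | nil => trivial
  | cons j l ih =>
    rw [List.nodup_cons] at hl
    refine ⟨?_, ih hl.2⟩
    obtain ⟨c, hc, hcj⟩ := h j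
    refine ⟨c, fun w hw => ?_, hcj⟩
    obtain ⟨i, hi, rfl⟩ := List.mem_map.1 hw
    exact hc i fun hij => hl.1 (hij ▸ hi)

end DualForms

end

/-! ### Logarithmic forms -/

open ExteriorAlgebra (ι)

lemma exists_eq_smul_of_isRelPrime {R M : Type*} [CommRing R] [IsDomain R]
    [DecompositionMonoid R] [AddCommGroup M] [Module R M] [Module.Free R M] {p q : R}
    (hq : q ≠ 0) (h : IsRelPrime p q) {u v : M} (huv : p • u = q • v) : ∃ w, u = q • w := by
  let b := Module.Free.chooseBasis R M
  have hdvd (i) : q ∣ b.repr u i := by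
    refine h.symm.dvd_of_dvd_mul_left ⟨b.repr v i, ?_⟩
    simpa using congrArg (fun w => b.repr w i) huv
  choose c hc using hdvd
  refine ⟨b.repr.symm (Finsupp.onFinset (b.repr u).support c fun i hi => ?_), ?_⟩
  · rw [Finsupp.mem_support_iff, hc i]
    exact mul_ne_zero hq hi
  · rw [← map_smul, LinearEquiv.eq_symm_apply]
    ext i
    simp [hc i]

/-- Finitely many pairwise relatively prime elements `f i` with vectors `α i`, to be thought of
as the differentials of the `f i`. -/
structure LogSystem (R V J : Type*) [CommRing R] [AddCommGroup V] [Module R V] where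
  f : J → R
  α : J → V
  f_ne : ∀ i, f i ≠ 0
  relPrime : ∀ i j, i ≠ j → IsRelPrime (f i) (f j)

namespace LogSystem

variable {R V J : Type*} [CommRing R] [AddCommGroup V] [Module R V] (L : LogSystem R V J)

/-- The forms `ω` such that `α i ∧ ω` is divisible by `f i` for `i ∈ T`: the product of the
`f i` times the forms with logarithmic poles along `f i = 0`. -/
def logForms (T : Set J) : Submodule R (ExteriorAlgebra R V) where
  carrier := {ω | ∀ i ∈ T, ∃ ω', ι R (L.α i) * ω = L.f i • ω'}
  zero_mem' i _ := ⟨0, by simp⟩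
  add_mem' {a b} ha hb i hi := by
    obtain ⟨a', ha'⟩ := ha i hi
    obtain ⟨b', hb'⟩ := hb i hi
    exact ⟨a' + b', by rw [mul_add, ha', hb', smul_add]⟩
  smul_mem' r a ha i hi := by
    obtain ⟨a', ha'⟩ := ha i hi
    exact ⟨r • a', by rw [mul_smul_comm, ha', smul_comm]⟩

lemma ι_mul_mem_logForms (v : V) {T : Set J} {ω : ExteriorAlgebra R V} (hω : ω ∈ L.logForms T) :
    ι R v * ω ∈ L.logForms T := by
  intro i hi
  obtain ⟨ω', h⟩ := hω i hi
  exact ⟨-(ι R v * ω'), by rw [ι_mul_ι_mul_swap, h, mul_smul_comm, smul_neg]⟩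

/-- The hypothesis says that the vector field c is tangent to the hypersurfaces f i = 0; this is
applied to the Euler field. -/
lemma contr_mem_logForms {c : Module.Dual R V} {T : Set J} (hc : ∀ i ∈ T, ∃ r, c (L.α i) = L.f i * r)
    {ω : ExteriorAlgebra R V} (hω : ω ∈ L.logForms T) : contr c ω ∈ L.logForms T := by
  intro i hi
  obtain ⟨ω', h⟩ := hω i hi
  obtain ⟨r, hr⟩ := hc i hi
  refine ⟨r • ω - contr c ω', ?_⟩
  have h1 := contr_ι_mul c (L.α i) ω
  rw [h, map_smul, hr] at h1
  rw [smul_sub, smul_smul, h1]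
  abel

/-- The residue-type operators `ω ↦ (α i ∧ ω) / f i`. -/
def resFun (i : J) (ω : L.logForms Set.univ) : ExteriorAlgebra R V :=
  Classical.choose (ω.2 i (Set.mem_univ i))

lemma smul_resFun (i : J) (ω : L.logForms Set.univ) :
    L.f i • L.resFun i ω = ι R (L.α i) * ω :=
  (Classical.choose_spec (ω.2 i (Set.mem_univ i))).symm

variable [IsDomain R] [Module.Free R V]

lemma smul_cancel (i : J) {a b : ExteriorAlgebra R V} (h : L.f i • a = L.f i • b) : a = b :=
  smul_right_injective _ (L.f_ne i) h

variable [DecompositionMonoid R]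

/-- Dividing α i ∧ ω by f i stays among logarithmic forms: for j ≠ i, f i (α j ∧ ω') is divisible by
f j, which is prime to f i; for j = i the wedge is zero. -/
lemma mem_logForms_of_smul_eq {T : Set J} {i : J} {ω ω' : ExteriorAlgebra R V}
    (hω : ω ∈ L.logForms T) (h : ι R (L.α i) * ω = L.f i • ω') : ω' ∈ L.logForms T := by
  intro j hj
  rcases eq_or_ne i j with rfl | hij
  · refine ⟨0, L.smul_cancel i ?_⟩
    rw [← mul_smul_comm, ← h, ι_mul_ι_mul_self]
    simp
  · obtain ⟨ω'', h''⟩ := hω j hj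
    refine exists_eq_smul_of_isRelPrime (v := -(ι R (L.α i) * ω'')) (L.f_ne j)
      (L.relPrime i j hij) ?_
    rw [← mul_smul_comm, ← h, ι_mul_ι_mul_swap, h'', mul_smul_comm, smul_neg]

lemma resFun_mem (i : J) (ω : L.logForms Set.univ) : L.resFun i ω ∈ L.logForms Set.univ :=
  L.mem_logForms_of_smul_eq ω.2 (L.smul_resFun i ω).symm

/-- The operators `ω ↦ (α i ∧ ω) / f i` on logarithmic forms. -/
def res (i : J) : Module.End R (L.logForms Set.univ) where
  toFun ω := ⟨L.resFun i ω, L.resFun_mem i ω⟩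
  map_add' a b := Subtype.ext <| L.smul_cancel i <| by
    simp only [Submodule.coe_add, smul_add, smul_resFun, mul_add]
  map_smul' r a := Subtype.ext <| L.smul_cancel i <| by
    simp only [Submodule.coe_smul, smul_resFun, mul_smul_comm, RingHom.id_apply,
      smul_comm (L.f i) r]

lemma smul_res (i : J) (ω : L.logForms Set.univ) :
    L.f i • (L.res i ω : ExteriorAlgebra R V) = ι R (L.α i) * ω :=
  L.smul_resFun i ω

/-- Exterior multiplication by a vector on logarithmic forms. -/
def wedge : V →ₗ[R] Module.End R (L.logForms Set.univ) where
  toFun v :=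
    { toFun := fun ω => ⟨ι R v * ω, L.ι_mul_mem_logForms v ω.2⟩
      map_add' := fun a b => Subtype.ext (mul_add _ _ _)
      map_smul' := fun r a => Subtype.ext (mul_smul_comm _ _ _) }
  map_add' u v := by
    ext ω
    change ι R (u + v) * (ω : ExteriorAlgebra R V) = ι R u * ω + ι R v * ω
    rw [map_add, add_mul]
  map_smul' r v := by
    ext ω
    change ι R (r • v) * (ω : ExteriorAlgebra R V) = r • (ι R v * ω)
    rw [map_smul, smul_mul_assoc]

variable [Fintype J] [DecidableEq J]

/-- The action of `V` by exterior multiplication and of the basis vectors of `J → R` by the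
operators `res`. -/
def actVec : V × (J → R) →ₗ[R] Module.End R (L.logForms Set.univ) :=
  LinearMap.coprod L.wedge (∑ i, (LinearMap.proj i).smulRight (L.res i))

omit [DecidableEq J] in
lemma actVec_apply (w : V × (J → R)) (ω : L.logForms Set.univ) :
    (L.actVec w ω : ExteriorAlgebra R V) =
      ι R w.1 * ω + ∑ i, w.2 i • (L.res i ω : ExteriorAlgebra R V) := by
  have h : L.actVec w = L.wedge w.1 + ∑ i, w.2 i • L.res i := by
    simp [actVec, LinearMap.coprod_apply, LinearMap.sum_apply]
  rw [h, LinearMap.add_apply, LinearMap.sum_apply]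
  simp only [Submodule.coe_add, Submodule.coe_sum, LinearMap.smul_apply, Submodule.coe_smul]
  rfl

/-- The product of all `f i`. -/
def prod : R := ∏ i, L.f i

omit [Module.Free R V] [DecompositionMonoid R] [DecidableEq J] in
lemma prod_ne_zero : L.prod ≠ 0 := Finset.prod_ne_zero_iff.2 fun i _ => L.f_ne i

/-- The product of all `f j` with `j ≠ i`. -/
def coprod (i : J) : R := ∏ j ∈ Finset.univ.erase i, L.f j

omit [IsDomain R] [Module.Free R V] [DecompositionMonoid R] in
lemma mul_coprod (i : J) : L.f i * L.coprod i = L.prod :=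
  Finset.mul_prod_erase _ _ (Finset.mem_univ i)

/-- The vector by which `w` acts on logarithmic forms, up to the factor `L.prod`. -/
def clear (w : V × (J → R)) : V := L.prod • w.1 + ∑ i, (w.2 i * L.coprod i) • L.α i

/-- After clearing denominators the action is honest exterior multiplication. As forms are
torsion-free, identities such as `actVec_sq` can be checked there. -/
lemma prod_smul_actVec (w : V × (J → R)) (ω : L.logForms Set.univ) :
    L.prod • (L.actVec w ω : ExteriorAlgebra R V) = ι R (L.clear w) * ω := by
  rw [actVec_apply, clear, smul_add, Finset.smul_sum, map_add, add_mul, map_smul, smul_mul_assoc,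
    map_sum, Finset.sum_mul]
  congr 1
  refine Finset.sum_congr rfl fun i _ => ?_
  rw [map_smul, smul_mul_assoc, ← L.smul_res, smul_smul, smul_smul, ← L.mul_coprod i]
  congr 1
  ring

lemma actVec_sq (w : V × (J → R)) : L.actVec w * L.actVec w = 0 := by
  ext ω
  have h : L.prod • L.prod • (L.actVec w (L.actVec w ω) : ExteriorAlgebra R V) = 0 := by
    rw [prod_smul_actVec, ← mul_smul_comm, prod_smul_actVec, ι_mul_ι_mul_self]
  exact (smul_eq_zero.1 ((smul_eq_zero.1 h).resolve_left L.prod_ne_zero)).resolve_left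
    L.prod_ne_zero

/-- The action of the exterior algebra of `V × (J → R)` on logarithmic forms. -/
def act : ExteriorAlgebra R (V × (J → R)) →ₐ[R] Module.End R (L.logForms Set.univ) :=
  ExteriorAlgebra.lift R ⟨L.actVec, L.actVec_sq⟩

lemma act_ι_mul (w : V × (J → R)) (η : ExteriorAlgebra R (V × (J → R)))
    (ω : L.logForms Set.univ) : L.act (ι R w * η) ω = L.actVec w (L.act η ω) := by
  rw [map_mul, Module.End.mul_apply]
  exact congrArg (fun e => e (L.act η ω)) (ExteriorAlgebra.lift_ι_apply R L.actVec L.actVec_sq w)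

lemma actVec_mem_extDeg (w : V × (J → R)) {ω : L.logForms Set.univ} {k : ℕ}
    (hω : (ω : ExteriorAlgebra R V) ∈ extDeg R V k) :
    (L.actVec w ω : ExteriorAlgebra R V) ∈ extDeg R V (k + 1) := by
  refine mem_extDeg_of_smul_mem L.prod_ne_zero ?_
  rw [prod_smul_actVec]
  exact ι_mul_mem _ hω

/-- The product of the `f i`, as a logarithmic form. -/
def one : L.logForms Set.univ :=
  ⟨algebraMap R _ L.prod, fun i _ => ⟨L.coprod i • ι R (L.α i), by
    rw [← Algebra.commutes, ← Algebra.smul_def, smul_smul, L.mul_coprod]⟩⟩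

lemma act_one_mem_extDeg {k : ℕ} {η : ExteriorAlgebra R (V × (J → R))}
    (hη : η ∈ extDeg R (V × (J → R)) k) :
    (L.act η L.one : ExteriorAlgebra R V) ∈ extDeg R V k := by
  match k with
  | 0 =>
    rw [extDeg, Submodule.mem_bot] at hη
    simp [hη]
  | 1 =>
    obtain ⟨r, rfl⟩ := mem_extDeg_one hη
    have : (L.act (algebraMap R _ r) L.one : ExteriorAlgebra R V) =
        algebraMap R _ (r * L.prod) := by
      rw [AlgHom.commutes, Module.algebraMap_end_apply, Submodule.coe_smul, map_mul,
        ← Algebra.smul_def]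
      rfl
    rw [this]
    change algebraMap R _ (r * L.prod) ∈ LinearMap.range (ι R (M := V)) ^ 0
    rw [pow_zero]
    exact Submodule.algebraMap_mem _
  | k + 2 =>
    refine extDeg_induction
      (p := fun η => (L.act η L.one : ExteriorAlgebra R V) ∈ extDeg R V (k + 2))
      (fun x y hx hy => ?_) (fun w η hη => ?_) hη
    · rw [map_add]
      exact add_mem hx hy
    · rw [act_ι_mul]
      exact L.actVec_mem_extDeg w (act_one_mem_extDeg hη)

/-- The relation `α i - f i • e i` between exterior multiplication by `α i` and `res i`. -/
def rel (i : J) : V × (J → R) := (L.α i, Pi.single i (-L.f i))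

lemma actVec_rel (i : J) : L.actVec (L.rel i) = 0 := by
  ext ω
  rw [actVec_apply]
  simp only [rel]
  rw [Finset.sum_eq_single i (fun j _ hj => by simp [hj]) (by simp), Pi.single_eq_same, neg_smul,
    smul_res, add_neg_cancel]
  rfl

variable {l : List J}

lemma act_eq_zero_of_mem {k : ℕ} {η : ExteriorAlgebra R (V × (J → R))}
    (hη : η ∈ vecIdeal (l.map L.rel) k) : L.act η = 0 := by
  induction l generalizing η with
  | nil =>
    rw [List.map_nil, vecIdeal, Submodule.mem_bot] at hη
    simp [hη]
  | cons i l ih =>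
    rw [List.map_cons] at hη
    obtain ⟨ζ, hζ, y, hy, rfl⟩ := mem_vecIdeal_cons.1 hη
    rw [map_add, ih hy, add_zero]
    ext ω
    rw [act_ι_mul, actVec_rel]
    rfl

/-- The inclusion of the exterior algebra of `V` in that of `V × (J → R)`. -/
def emb : ExteriorAlgebra R V →ₐ[R] ExteriorAlgebra R (V × (J → R)) :=
  ExteriorAlgebra.map (LinearMap.inl R V (J → R))

lemma act_emb (η : ExteriorAlgebra R V) (ω : L.logForms Set.univ) :
    (L.act (emb η) ω : ExteriorAlgebra R V) = η * ω := by
  induction η using ExteriorAlgebra.induction generalizing ω with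
  | algebraMap r =>
    rw [AlgHom.commutes, AlgHom.commutes, Module.algebraMap_end_apply, Submodule.coe_smul,
      Algebra.smul_def]
  | ι v =>
    have h := L.act_ι_mul (LinearMap.inl R V (J → R) v) 1 ω
    rw [mul_one, map_one, Module.End.one_apply] at h
    rw [emb, ExteriorAlgebra.map_apply_ι, h, actVec_apply]
    simp
  | mul a b ha hb => rw [map_mul, map_mul, Module.End.mul_apply, ha, hb, mul_assoc]
  | add a b ha hb =>
    rw [map_add, map_add, LinearMap.add_apply, Submodule.coe_add, ha, hb, add_mul]

omit [IsDomain R] [Module.Free R V] [DecompositionMonoid R] [Fintype J] [DecidableEq J] in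
lemma emb_ι (v : V) : emb (J := J) (ι R v) = ι R ((v, 0) : V × (J → R)) :=
  ExteriorAlgebra.map_apply_ι _ _

omit [Module.Free R V] [DecompositionMonoid R] in
lemma prod_smul_eq (w : V × (J → R)) :
    L.prod • w = (L.clear w, 0) - ∑ i, (w.2 i * L.coprod i) • L.rel i := by
  ext1
  · simp [clear, rel, Prod.fst_sum]
  · funext j
    simp only [Prod.snd_sub, Prod.snd_sum, rel, Prod.smul_snd, Pi.sub_apply, Finset.sum_apply,
      Pi.smul_apply, smul_eq_mul, Pi.zero_apply, zero_sub]
    rw [Finset.sum_eq_single j (fun i _ hi => by simp [Pi.single_eq_of_ne hi.symm]) (by simp),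
      Pi.single_eq_same, ← L.mul_coprod j]
    ring

omit [Module.Free R V] [DecompositionMonoid R] in
-- Once the f i are inverted, the relations read e i = α i / f i, so every element comes from the
-- exterior algebra of V.
lemma exists_smul_sub_emb_mem (hl : ∀ i, i ∈ l) {k : ℕ} {η : ExteriorAlgebra R (V × (J → R))}
    (hη : η ∈ extDeg R (V × (J → R)) k) :
    ∃ r : R, r ≠ 0 ∧ ∃ ω : ExteriorAlgebra R V, r • η - emb ω ∈ vecIdeal (l.map L.rel) k := by
  match k with
  | 0 =>
    rw [extDeg, Submodule.mem_bot] at hη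
    exact ⟨1, one_ne_zero, 0, by simp [hη]⟩
  | 1 =>
    obtain ⟨r, rfl⟩ := mem_extDeg_one hη
    refine ⟨1, one_ne_zero, algebraMap R _ r, ?_⟩
    rw [AlgHom.commutes, one_smul, sub_self]
    exact zero_mem _
  | k + 2 =>
    refine extDeg_induction (p := fun η => ∃ r : R, r ≠ 0 ∧ ∃ ω : ExteriorAlgebra R V,
      r • η - emb ω ∈ vecIdeal (l.map L.rel) (k + 2)) ?_ ?_ hη
    · rintro x y ⟨r, hr, ω, h⟩ ⟨r', hr', ω', h'⟩
      refine ⟨r * r', mul_ne_zero hr hr', r' • ω + r • ω', ?_⟩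
      have := add_mem (Submodule.smul_mem _ r' h) (Submodule.smul_mem _ r h')
      convert this using 1
      rw [map_add, map_smul, map_smul, smul_sub, smul_sub, smul_add, smul_smul, smul_smul,
        mul_comm r' r]
      abel
    · intro w η hη
      obtain ⟨r, hr, ω, h⟩ := exists_smul_sub_emb_mem hl hη
      refine ⟨L.prod * r, mul_ne_zero L.prod_ne_zero hr, ι R (L.clear w) * ω, ?_⟩
      have h1 := ι_mul_mem_vecIdeal ((L.clear w, 0) : V × (J → R)) h
      have h2 : ∑ i, (w.2 i * L.coprod i) • (ι R (L.rel i) * r • η) ∈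
          vecIdeal (l.map L.rel) (k + 2) :=
        sum_mem fun i _ => Submodule.smul_mem _ _
          (ι_mul_mem_vecIdeal_of_mem (List.mem_map_of_mem (hl i)) (Submodule.smul_mem _ r hη))
      convert sub_mem h1 h2 using 1
      have h3 : L.prod • (ι R w * r • η) = ι R ((L.clear w, 0) : V × (J → R)) * r • η -
          ∑ i, (w.2 i * L.coprod i) • (ι R (L.rel i) * r • η) := by
        rw [← smul_mul_assoc, ← map_smul, prod_smul_eq, map_sub, sub_mul, map_sum, Finset.sum_mul]
        simp only [map_smul, smul_mul_assoc]
      rw [mul_smul, ← mul_smul_comm r, h3, map_mul, emb_ι, mul_sub]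
      abel

/-- If `η` annihilates `L.one`, then `η` is a torsion element modulo the relations. -/
lemma exists_smul_mem_of_act_eq_zero (hl : ∀ i, i ∈ l) {k : ℕ}
    {η : ExteriorAlgebra R (V × (J → R))} (hη : η ∈ extDeg R (V × (J → R)) k)
    (h : L.act η L.one = 0) : ∃ r : R, r ≠ 0 ∧ r • η ∈ vecIdeal (l.map L.rel) k := by
  obtain ⟨r, hr, ω, hω⟩ := L.exists_smul_sub_emb_mem hl hη
  refine ⟨r, hr, ?_⟩
  have h1 := congrArg (fun e => (e L.one : ExteriorAlgebra R V)) (L.act_eq_zero_of_mem hω)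
  simp only [map_sub, map_smul, LinearMap.sub_apply, LinearMap.smul_apply, h, smul_zero, zero_sub,
    LinearMap.zero_apply, Submodule.coe_neg, Submodule.coe_zero, act_emb, neg_eq_zero] at h1
  have h2 : L.prod • ω = 0 := by
    rw [Algebra.smul_def, Algebra.commutes]
    exact h1
  rw [(smul_eq_zero.1 h2).resolve_left L.prod_ne_zero, map_zero, sub_zero] at hω
  exact hω

/-- The product w∧η is torsion modulo the relations; contracting with c, which respects the
relations, gives c(w)η modulo w. -/
lemma exists_smul_mem_of_act_ι_mul_eq_zero (hl : ∀ i, i ∈ l) {c : Module.Dual R (V × (J → R))}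
    (hc : ∀ i, c (L.rel i) = 0) {w : V × (J → R)} (hw : c w ≠ 0) {k : ℕ}
    {η : ExteriorAlgebra R (V × (J → R))} (hη : η ∈ extDeg R (V × (J → R)) k)
    (h : L.act (ι R w * η) L.one = 0) :
    ∃ r : R, r ≠ 0 ∧ r • η ∈ vecIdeal (w :: l.map L.rel) k := by
  obtain ⟨r, hr, hrη⟩ := L.exists_smul_mem_of_act_eq_zero hl (ι_mul_mem w hη) h
  refine ⟨r * c w, mul_ne_zero hr hw, ?_⟩
  have h2 := contr_mem_vecIdeal (c := c) (fun v hv => by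
    obtain ⟨i, -, rfl⟩ := List.mem_map.1 hv
    exact hc i) hrη
  rw [map_smul, contr_ι_mul] at h2
  refine mem_vecIdeal_cons.2 ⟨r • contr c η, Submodule.smul_mem _ _ (contr_mem c hη), _, h2, ?_⟩
  rw [smul_sub, mul_smul, mul_smul_comm, add_sub_cancel]

/-- Locally the logarithmic forms are generated by `L.one`: `c i`, `i ∈ S`, are linear forms which
at the given point are dual to the `α i`. -/
lemma exists_act_eq_smul {S : Finset J} {c : J → Module.Dual R V}
    (hc : ∀ i ∈ S, ∀ j ∈ S, j ≠ i → c i (L.α j) = 0) {T : Finset J} (hT : T ⊆ S) {k : ℕ}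
    {ω : ExteriorAlgebra R V} (hω : ω ∈ extDeg R V k) (hlog : ω ∈ L.logForms T) :
    ∃ η ∈ extDeg R (V × (J → R)) k, (L.act η L.one : ExteriorAlgebra R V) =
      ((∏ i ∈ Tᶜ, L.f i) * ∏ i ∈ T, c i (L.α i)) • ω := by
  induction T using Finset.induction_on generalizing k ω with
  | empty =>
    refine ⟨emb ω, ?_, ?_⟩
    · cases k with
      | zero =>
        rw [extDeg, Submodule.mem_bot] at hω
        simp [hω]
      | succ k =>
        have h := Submodule.mem_map_of_mem (f := (emb (R := R) (J := J)).toLinearMap) hω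
        change emb ω ∈ LinearMap.range (ι R (M := V × (J → R))) ^ k
        change _ ∈ Submodule.map _ (LinearMap.range (ι R (M := V)) ^ k) at h
        rw [Submodule.map_pow] at h
        have hle : Submodule.map (emb (R := R) (J := J)).toLinearMap
            (LinearMap.range (ι R (M := V))) ≤ LinearMap.range (ι R (M := V × (J → R))) := by
          rintro _ ⟨_, ⟨v, rfl⟩, rfl⟩
          exact ⟨(v, 0), (emb_ι v).symm⟩
        have hpow := pow_le_pow_left' hle k
        exact hpow h
    · rw [act_emb, Finset.compl_empty, Finset.prod_empty, mul_one, Algebra.smul_def,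
        Algebra.commutes]
      rfl
  | insert i T hi ih =>
    obtain _ | k := k
    · rw [extDeg, Submodule.mem_bot] at hω
      exact ⟨0, zero_mem _, by simp [hω]⟩
    have hiS : i ∈ S := hT (Finset.mem_insert_self i T)
    have hTS : T ⊆ S := fun j hj => hT (Finset.mem_insert_of_mem hj)
    have hlogT : ω ∈ L.logForms T := fun j hj => hlog j (by simp [Finset.mem_coe.1 hj])
    have hcT : ∀ j ∈ (T : Set J), ∃ r, c i (L.α j) = L.f j * r := fun j hj =>
      ⟨0, by rw [hc i hiS j (hTS hj) (fun h => hi (h ▸ hj)), mul_zero]⟩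
    obtain ⟨ω', hω'⟩ := hlog i (by simp)
    have hdeg : ω' ∈ extDeg R V (k + 2) :=
      mem_extDeg_of_smul_mem (L.f_ne i) (hω' ▸ ι_mul_mem _ hω)
    have hlog' : ω' ∈ L.logForms T := L.mem_logForms_of_smul_eq hlogT hω'
    obtain ⟨η₁, hη₁, h₁⟩ := ih hTS (contr_mem (c i) hω) (L.contr_mem_logForms hcT hlogT)
    obtain ⟨η₂, hη₂, h₂⟩ := ih hTS (contr_mem (c i) hdeg) (L.contr_mem_logForms hcT hlog')
    -- With α i ∧ ω = f i ω', contraction gives c(α i) ω = f i (`res i` (c ω) + c ω'), up to the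
    -- cancelled f i. Both c ω and c ω' are logarithmic along T, so induction represents them by η₁
    -- and η₂. The factor f i that the inductive multiplier has in excess is cancelled.
    refine ⟨ι R ((0, Pi.single i 1) : V × (J → R)) * η₁ + η₂, add_mem (ι_mul_mem _ hη₁) hη₂,
      L.smul_cancel i ?_⟩
    have h3 := contr_ι_mul (c i) (L.α i) ω
    rw [hω', map_smul] at h3
    have h4 : (L.act (ι R ((0, Pi.single i 1) : V × (J → R)) * η₁ + η₂) L.one :
        ExteriorAlgebra R V) = L.res i (L.act η₁ L.one) + L.act η₂ L.one := by
      rw [map_add, LinearMap.add_apply, Submodule.coe_add, act_ι_mul, actVec_apply]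
      simp only [map_zero, zero_mul, zero_add]
      rw [Finset.sum_eq_single i (fun j _ hj => by simp [hj]) (by simp), Pi.single_eq_same,
        one_smul]
    have h5 : ∏ j ∈ Tᶜ, L.f j = L.f i * ∏ j ∈ (insert i T)ᶜ, L.f j := by
      rw [Finset.compl_insert, Finset.mul_prod_erase _ _ (by simpa using hi)]
    rw [h4, smul_add, smul_res, h₁, h₂, mul_smul_comm, Finset.prod_insert hi,
      smul_comm (L.f i), ← smul_add, h3, add_sub_cancel, h5, smul_smul, smul_smul]
    congr 1
    ring

end LogSystem

/-! ### Differentials, the Euler field and coprimality -/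

open MvPolynomial

section Geometry

variable {F : Type u} [Field F] {n : ℕ}

/-- The differential of a polynomial. -/
abbrev diff (p : MvPolynomial (Fin n) F) :
    KaehlerDifferential F (MvPolynomial (Fin n) F) :=
  KaehlerDifferential.D F (MvPolynomial (Fin n) F) p

variable (F n) in
/-- The linear form on `1`-forms given by the Euler vector field `∑ xᵢ ∂/∂xᵢ`. -/
def euler : Module.Dual (MvPolynomial (Fin n) F)
    (KaehlerDifferential F (MvPolynomial (Fin n) F)) :=
  (KaehlerDifferential.mvPolynomialBasis F (Fin n)).constr F fun i => X i

lemma euler_diff {p : MvPolynomial (Fin n) F} {d : ℕ} (hp : p.IsHomogeneous d) :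
    euler F n (diff p) = (d : MvPolynomial (Fin n) F) * p := by
  rw [euler, Module.Basis.constr_apply_fintype, ← nsmul_eq_mul, ← hp.sum_X_mul_pderiv]
  refine Finset.sum_congr rfl fun i _ => ?_
  rw [Module.Basis.equivFun_apply, KaehlerDifferential.mvPolynomialBasis_repr_apply, smul_eq_mul,
    mul_comm]

lemma sum_mul_aeval_pderiv {p : MvPolynomial (Fin n) F} {d : ℕ} (hp : p.IsHomogeneous d)
    (x : Fin n → AlgebraicClosure F) :
    ∑ i, x i * aeval x (pderiv i p) = d * aeval x p := by
  have h := congrArg (aeval x) hp.sum_X_mul_pderiv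
  simpa using h

lemma natCast_algebraicClosure_ne_zero {k : ℕ} (h : (k : F) ≠ 0) :
    (k : AlgebraicClosure F) ≠ 0 := by
  rw [← map_natCast (algebraMap F (AlgebraicClosure F))]
  exact (map_ne_zero _).2 h

/-- `∏ i ∈ s, g i ^ a i` divided by `g i`, times `a i`. -/
def logCoeff {J : Type*} [DecidableEq J] (g : J → MvPolynomial (Fin n) F) (a : J → ℕ)
    (s : Finset J) (i : J) : MvPolynomial (Fin n) F :=
  (a i : MvPolynomial (Fin n) F) * g i ^ (a i - 1) * ∏ j ∈ s.erase i, g j ^ a j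

lemma diff_prod_pow {J : Type*} [DecidableEq J] (g : J → MvPolynomial (Fin n) F) (a : J → ℕ)
    (s : Finset J) :
    diff (∏ i ∈ s, g i ^ a i) = ∑ i ∈ s, logCoeff g a s i • diff (g i) := by
  induction s using Finset.induction_on with
  | empty => simp [diff]
  | insert i s hi ih =>
    rw [Finset.prod_insert hi, Finset.sum_insert hi, diff, Derivation.leibniz]
    rw [diff] at ih
    rw [ih, Derivation.leibniz_pow, add_comm]
    congr 1
    · rw [logCoeff, Finset.erase_insert hi, ← Nat.cast_smul_eq_nsmul (MvPolynomial (Fin n) F),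
        smul_smul, smul_smul]
      congr 1
      ring
    · rw [Finset.smul_sum]
      refine Finset.sum_congr rfl fun j hj => ?_
      have hij : i ≠ j := fun h => hi (h ▸ hj)
      rw [smul_smul, logCoeff, logCoeff, Finset.erase_insert_of_ne hij,
        Finset.prod_insert (fun h => hi (Finset.mem_of_mem_erase h))]
      congr 1
      ring

lemma mul_logCoeff {J : Type*} [DecidableEq J] (g : J → MvPolynomial (Fin n) F) {a : J → ℕ}
    {s : Finset J} {i : J} (hi : i ∈ s) (ha : a i ≠ 0) :
    g i * logCoeff g a s i = (a i : MvPolynomial (Fin n) F) * ∏ j ∈ s, g j ^ a j := by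
  rw [← Finset.mul_prod_erase s _ hi, logCoeff, ← Nat.succ_pred_eq_of_ne_zero ha]
  simp only [Nat.succ_eq_add_one, Nat.pred_eq_sub_one, Nat.add_sub_cancel, pow_succ]
  ring

/-- A nonunit common factor c has a zero x ≠ 0: otherwise a power of each variable is divisible by
c, and an irreducible factor of c would be associated to two distinct variables. At x the gradients
of cr and cs are both multiples of the gradient of c, hence dependent. -/
lemma isRelPrime_of_linearIndependent (hn : 2 ≤ n) {p q : MvPolynomial (Fin n) F} (hp : p ≠ 0)
    (h : ∀ x : Fin n → AlgebraicClosure F, x ≠ 0 → aeval x p = 0 → aeval x q = 0 →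
      LinearIndependent (AlgebraicClosure F) ![fun j => aeval x (pderiv j p),
        fun j => aeval x (pderiv j q)]) : IsRelPrime p q := by
  intro c hcp hcq
  by_contra hc
  have hex : ∃ x : Fin n → AlgebraicClosure F, x ≠ 0 ∧ aeval x c = 0 := by
    by_contra! hne
    have hrad : ∀ i, (X i : MvPolynomial (Fin n) F) ∈ (Ideal.span {c}).radical :=
      X_mem_radical fun x hx => ⟨c, hne x hx, Ideal.mem_span_singleton_self c⟩
    obtain ⟨k, hk⟩ := hrad ⟨0, by omega⟩
    obtain ⟨l, hl⟩ := hrad ⟨1, by omega⟩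
    rw [Ideal.mem_span_singleton] at hk hl
    obtain ⟨q, hq, hqc⟩ := WfDvdMonoid.exists_irreducible_factor hc
      (fun h0 => hp (zero_dvd_iff.1 (h0 ▸ hcp)))
    have h1 := hq.prime.dvd_of_dvd_pow (hqc.trans hk)
    have h2 := hq.prime.dvd_of_dvd_pow (hqc.trans hl)
    have h4 := (hq.dvd_symm (X_prime (R := F) (i := (⟨0, by omega⟩ : Fin n))).irreducible h1).trans h2
    have h5 := (X_dvd_X (R := F)).1 h4
    simp at h5
  obtain ⟨x, hx, hcx⟩ := hex
  obtain ⟨r, rfl⟩ := hcp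
  obtain ⟨s, rfl⟩ := hcq
  have hind := h x hx (by simp [hcx]) (by simp [hcx])
  rw [LinearIndependent.pair_iff] at hind
  have h1 := hind (aeval x s) (-aeval x r) (by
    ext j
    simp [hcx]
    ring)
  have h2 := hind 1 0 (by
    ext j
    have : aeval x r = 0 := by simpa using h1.2
    simp [hcx, this])
  exact one_ne_zero h2.1

end Geometry

/-! ### Consequences of the smoothness hypotheses -/

/-- The hypotheses on the leading form `∏ i, g i ^ a i` of degree `δ` and the next form `G` of
degree `δ'`: the `g i` are homogeneous of degree `d i` and satisfy the smoothness conditions. -/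
structure IsAdmissible {F : Type u} [Field F] {n t : ℕ} (G : MvPolynomial (Fin n) F)
    (g : Fin t → MvPolynomial (Fin n) F) (a d : Fin t → ℕ) (δ δ' : ℕ) : Prop where
  homogeneous : ∀ i, (g i).IsHomogeneous (d i)
  homogeneous' : G.IsHomogeneous δ'
  homogeneous_prod : (∏ i, g i ^ a i).IsHomogeneous δ
  prod_ne : ∏ i, g i ^ a i ≠ 0
  cast_δ : (δ : F) ≠ 0
  cast_δ' : (δ' : F) ≠ 0
  cast_a : ∀ i, (a i : F) ≠ 0
  smooth : ∀ (S : Finset (Fin t)) (x : Fin n → AlgebraicClosure F), x ≠ 0 →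
    (∀ i ∈ S, aeval x (g i) = 0) →
      LinearIndependent (AlgebraicClosure F) fun (i : S) j => aeval x (pderiv j (g i))
  smooth' : ∀ S : Finset (Fin t), (2 ≤ S.card ∨ ∃ i, S = {i} ∧ 1 < a i) →
    ∀ x : Fin n → AlgebraicClosure F, x ≠ 0 → aeval x G = 0 → (∀ i ∈ S, aeval x (g i) = 0) →
      LinearIndependent (AlgebraicClosure F) fun (o : Option S) j =>
        aeval x (pderiv j (o.elim G fun i => g i))

namespace IsAdmissible

variable {F : Type u} [Field F] {n t : ℕ} {G : MvPolynomial (Fin n) F}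
    {g : Fin t → MvPolynomial (Fin n) F} {a d : Fin t → ℕ} {δ δ' : ℕ}
    (H : IsAdmissible G g a d δ δ')

include H

lemma a_ne (i : Fin t) : a i ≠ 0 := fun h => H.cast_a i (by simp [h])

lemma g_ne (i : Fin t) : g i ≠ 0 := fun h => H.prod_ne <|
  Finset.prod_eq_zero (Finset.mem_univ i) (by rw [h, zero_pow (H.a_ne i)])

lemma degree_eq : ∑ i, a i * d i = δ := by
  have h1 : (∏ i, g i ^ a i).IsHomogeneous (∑ i, a i * d i) := by
    refine IsHomogeneous.prod _ _ _ fun i _ => ?_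
    rw [mul_comm]
    exact (H.homogeneous i).pow (a i)
  exact h1.inj_right H.homogeneous_prod H.prod_ne

lemma isRelPrime (hn : 2 ≤ n) {i j : Fin t} (hij : i ≠ j) : IsRelPrime (g i) (g j) := by
  refine isRelPrime_of_linearIndependent hn (H.g_ne i) fun x hx hi hj => ?_
  have h := H.smooth {i, j} x hx (by simp [hi, hj])
  have h2 := h.comp ![⟨i, by simp⟩, ⟨j, by simp⟩] (by
    intro k l hkl
    fin_cases k <;> fin_cases l <;> simp_all [hij.symm])
  convert h2 using 1
  ext k
  fin_cases k <;> rfl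

/-- The polynomials `g i` with their differentials. -/
def logSystem (hn : 2 ≤ n) : LogSystem (MvPolynomial (Fin n) F)
    (KaehlerDifferential F (MvPolynomial (Fin n) F)) (Fin t) where
  f := g
  α i := diff (g i)
  f_ne := H.g_ne
  relPrime _ _ := H.isRelPrime hn

/-- Where G(x) ≠ 0, pairing a linear relation with x itself and using Euler's identity leaves only
the coefficient of the gradient of G times δ' G(x), so that coefficient vanishes. -/
lemma linearIndependent_option {S : Finset (Fin t)} (hS : 2 ≤ S.card ∨ ∃ i, S = {i} ∧ 1 < a i)
    {x : Fin n → AlgebraicClosure F} (hx : x ≠ 0) (hxS : ∀ i ∈ S, aeval x (g i) = 0) :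
    LinearIndependent (AlgebraicClosure F) fun (o : Option S) j =>
      aeval x (pderiv j (o.elim G fun i => g i)) := by
  by_cases hG : aeval x G = 0
  · exact H.smooth' S hS x hx hG hxS
  rw [Fintype.linearIndependent_iff]
  intro c hc
  have h0 : c none = 0 := by
    have h1 : ∑ j, x j * (∑ o : Option S, c o • fun j =>
        aeval x (pderiv j (o.elim G fun i => g i))) j = 0 := by
      rw [hc]; simp
    simp only [Finset.sum_apply, Pi.smul_apply, smul_eq_mul, Finset.mul_sum] at h1
    rw [Finset.sum_comm, Fintype.sum_option] at h1
    have h2 (p : MvPolynomial (Fin n) F) (y : AlgebraicClosure F) :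
        ∑ j, x j * (y * aeval x (pderiv j p)) = y * ∑ j, x j * aeval x (pderiv j p) := by
      rw [Finset.mul_sum]
      exact Finset.sum_congr rfl fun _ _ => by ring
    simp only [h2, Option.elim_none, Option.elim_some] at h1
    rw [Finset.sum_eq_zero (fun (i : S) _ => by
      rw [sum_mul_aeval_pderiv (H.homogeneous i), hxS i i.2, mul_zero, mul_zero]), add_zero,
      sum_mul_aeval_pderiv H.homogeneous', mul_eq_zero, mul_eq_zero] at h1
    refine h1.resolve_right (not_or.2 ⟨?_, hG⟩)
    exact natCast_algebraicClosure_ne_zero (H.cast_δ')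
  have h1 := Fintype.linearIndependent_iff.1 (H.smooth S x hx hxS) (fun i => c (some i)) (by
    rw [Fintype.sum_option, h0, zero_smul, zero_add] at hc
    exact hc)
  intro o
  cases o with
  | none => exact h0
  | some i => exact h1 i

lemma exists_dual_smooth {x : Fin n → AlgebraicClosure F} (hx : x ≠ 0) {S : Finset (Fin t)}
    (hxS : ∀ i ∈ S, aeval x (g i) = 0) {i : Fin t} (hi : i ∈ S) :
    ∃ c : Module.Dual (MvPolynomial (Fin n) F)
        (KaehlerDifferential F (MvPolynomial (Fin n) F)),
      (∀ j ∈ S, j ≠ i → c (diff (g j)) = 0) ∧ aeval x (c (diff (g i))) ≠ 0 := by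
  obtain ⟨c, hc, hci⟩ := exists_dual_ne_zero (KaehlerDifferential.mvPolynomialBasis F (Fin n)) x
    (v := fun j : S => diff (g j)) (by
      simpa only [KaehlerDifferential.mvPolynomialBasis_repr_apply] using H.smooth S x hx hxS)
    ⟨i, hi⟩
  exact ⟨c, fun j hj hji => hc ⟨j, hj⟩ (by simpa using hji), hci⟩

/-- The vector `∑ a i e i`, which acts on logarithmic forms by exterior multiplication with the
logarithmic differential of `∏ i, g i ^ a i`. -/
def _root_.PolyForms.logVec (F : Type u) [Field F] (n : ℕ) {t : ℕ} (a : Fin t → ℕ) :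
    KaehlerDifferential F (MvPolynomial (Fin n) F) × (Fin t → MvPolynomial (Fin n) F) :=
  (0, fun i => a i)

/-- A relation with coefficients c₀ and c_i says c₀ a_i = c_i g_i(x) and ∑ c_i ∇g_i(x) = 0. Pairing
the second with x gives c₀ ∑ a_i d_i = c₀ δ = 0. Then c_i = 0 wherever g_i(x) ≠ 0, and smoothness
disposes of the rest. -/
lemma linearIndependent_logVec (hn : 2 ≤ n) {x : Fin n → AlgebraicClosure F} (hx : x ≠ 0) :
    LinearIndependent (AlgebraicClosure F) fun (o : Option (Fin t)) j =>
      aeval x ((((KaehlerDifferential.mvPolynomialBasis F (Fin n)).prod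
        (Pi.basisFun (MvPolynomial (Fin n) F) (Fin t))).repr
          (o.elim (logVec F n a) (H.logSystem hn).rel)) j) := by
  have ha (i) : (a i : AlgebraicClosure F) ≠ 0 := by
    exact natCast_algebraicClosure_ne_zero (H.cast_a i)
  have hδ : (δ : AlgebraicClosure F) ≠ 0 := by
    exact natCast_algebraicClosure_ne_zero (H.cast_δ)
  rw [Fintype.linearIndependent_iff]
  intro c hc
  have hr (i : Fin t) : c none * a i = c (some i) * aeval x (g i) := by
    have h := congrFun hc (Sum.inr i)
    rw [Fintype.sum_option] at h
    simp only [Pi.add_apply, Finset.sum_apply, Pi.smul_apply, Option.elim_none, Option.elim_some,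
      Module.Basis.prod_repr_inr, Pi.basisFun_repr, logVec, LogSystem.rel, logSystem,
      map_natCast, smul_eq_mul, Pi.zero_apply] at h
    rw [Finset.sum_eq_single i (fun j _ hj => by simp [Pi.single_eq_of_ne hj.symm]) (by simp)] at h
    simp only [Pi.single_eq_same, map_neg] at h
    linear_combination h
  have hl (j : Fin n) : ∑ i, c (some i) * aeval x (pderiv j (g i)) = 0 := by
    have h := congrFun hc (Sum.inl j)
    rw [Fintype.sum_option] at h
    simpa [logVec, LogSystem.rel, logSystem, Module.Basis.prod_repr_inl,
      KaehlerDifferential.mvPolynomialBasis_repr_apply] using h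
  have h0 : c none = 0 := by
    have h1 : ∑ j, x j * ∑ i, c (some i) * aeval x (pderiv j (g i)) = 0 := by simp [hl]
    simp only [Finset.mul_sum] at h1
    rw [Finset.sum_comm] at h1
    have h2 (i : Fin t) : ∑ j, x j * (c (some i) * aeval x (pderiv j (g i))) =
        c none * ((a i * d i : ℕ) : AlgebraicClosure F) := by
      have h3 : ∑ j, x j * (c (some i) * aeval x (pderiv j (g i))) =
          c (some i) * ∑ j, x j * aeval x (pderiv j (g i)) := by
        rw [Finset.mul_sum]
        exact Finset.sum_congr rfl fun _ _ => by ring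
      rw [h3, sum_mul_aeval_pderiv (H.homogeneous i)]
      push_cast
      linear_combination (-(d i : AlgebraicClosure F)) * hr i
    rw [Finset.sum_congr rfl fun i _ => h2 i, ← Finset.mul_sum, ← Nat.cast_sum, H.degree_eq] at h1
    exact (mul_eq_zero.1 h1).resolve_right hδ
  classical
  let S : Finset (Fin t) := Finset.univ.filter fun i => aeval x (g i) = 0
  have hout : ∀ i, i ∉ S → c (some i) = 0 := by
    intro i hi
    have h := hr i
    rw [h0, zero_mul, eq_comm, mul_eq_zero] at h
    exact h.resolve_right (by simpa [S] using hi)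
  have h1 := Fintype.linearIndependent_iff.1 (H.smooth S x hx (by simp [S]))
    (fun i => c (some i)) (by
      ext j
      simp only [Finset.sum_apply, Pi.smul_apply, smul_eq_mul, Pi.zero_apply]
      rw [Finset.sum_coe_sort S fun i => c (some i) * aeval x (pderiv j (g i)), ← hl j]
      exact Finset.sum_subset (Finset.subset_univ S) fun i _ hi => by rw [hout i hi, zero_mul])
  intro o
  cases o with
  | none => exact h0
  | some i =>
    by_cases hi : i ∈ S
    · exact h1 ⟨i, hi⟩
    · exact hout i hi

lemma hasDualForms (hn : 2 ≤ n) {x : Fin n → AlgebraicClosure F} (hx : x ≠ 0) :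
    HasDualForms x (logVec F n a :: (List.finRange t).map (H.logSystem hn).rel) := by
  have h := hasDualForms_map (x := x)
    (v := fun o : Option (Fin t) => o.elim (logVec F n a) (H.logSystem hn).rel)
    (fun o => exists_dual_ne_zero _ x (H.linearIndependent_logVec hn hx) o)
    (l := none :: (List.finRange t).map some) (by
      rw [List.nodup_cons]
      exact ⟨by simp, (List.nodup_finRange t).map (Option.some_injective _)⟩)
  simpa [Function.comp_def] using h

end IsAdmissible

/-! ### Forms killed by the differential of the leading form -/

section

variable {F : Type u} [Field F] {n : ℕ}

/-- The homogeneous forms (in the shifted grading) killed by `dp`. -/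
def kerDeg (p : MvPolynomial (Fin n) F) (k : ℕ) : Submodule (MvPolynomial (Fin n) F) (Forms F n) :=
  extDeg (MvPolynomial (Fin n) F) (KaehlerDifferential F (MvPolynomial (Fin n) F)) k ⊓
    LinearMap.ker (LinearMap.mulLeft (MvPolynomial (Fin n) F) (ι (MvPolynomial (Fin n) F) (diff p)))

lemma mem_kerDeg {p : MvPolynomial (Fin n) F} {k : ℕ} {ω : Forms F n} :
    ω ∈ kerDeg p k ↔ ω ∈ extDeg (MvPolynomial (Fin n) F)
      (KaehlerDifferential F (MvPolynomial (Fin n) F)) k ∧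
      ι (MvPolynomial (Fin n) F) (diff p) * ω = 0 := Iff.rfl

/-- The exact homogeneous forms (in the shifted grading) for the differential `dp`. -/
def imDeg (p : MvPolynomial (Fin n) F) (k : ℕ) : Submodule (MvPolynomial (Fin n) F) (Forms F n) :=
  (extDeg (MvPolynomial (Fin n) F) (KaehlerDifferential F (MvPolynomial (Fin n) F)) (k - 1)).map
    (LinearMap.mulLeft (MvPolynomial (Fin n) F) (ι (MvPolynomial (Fin n) F) (diff p)))

lemma imDeg_le_kerDeg {p : MvPolynomial (Fin n) F} (k : ℕ) : imDeg p k ≤ kerDeg p k := by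
  rintro _ ⟨η, hη, rfl⟩
  rw [LinearMap.mulLeft_apply, mem_kerDeg]
  refine ⟨?_, ι_mul_ι_mul_self _ _⟩
  cases k with
  | zero =>
    rw [SetLike.mem_coe, extDeg, Submodule.mem_bot] at hη
    simp [hη]
  | succ k => exact ι_mul_mem _ hη

lemma smul_eq_contr_euler {p : MvPolynomial (Fin n) F} {e : ℕ} (hp : p.IsHomogeneous e)
    {ω : Forms F n} (hω : ι (MvPolynomial (Fin n) F) (diff p) * ω = 0) :
    ((e : MvPolynomial (Fin n) F) * p) • ω =
      ι (MvPolynomial (Fin n) F) (diff p) * contr (euler F n) ω := by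
  have h := contr_ι_mul (euler F n) (diff p) ω
  rw [hω, map_zero, euler_diff hp] at h
  exact (sub_eq_zero.1 h.symm)

end

namespace IsAdmissible

variable {F : Type u} [Field F] {n t : ℕ} {G : MvPolynomial (Fin n) F}
    {g : Fin t → MvPolynomial (Fin n) F} {a d : Fin t → ℕ} {δ δ' : ℕ}
    (H : IsAdmissible G g a d δ δ')

include H

/-- In the expansion of dΦ∧ω all terms but the i-th are divisible by g_i^{a_i}. The i-th is a_i
g_i^{a_i - 1} P (dg_i∧ω) with P prime to g_i and a_i invertible, so g_i divides dg_i∧ω. -/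
lemma mem_logForms (hn : 2 ≤ n) {ω : Forms F n}
    (hω : ι (MvPolynomial (Fin n) F) (diff (∏ i, g i ^ a i)) * ω = 0) :
    ω ∈ (H.logSystem hn).logForms Set.univ := by
  intro i _
  change ∃ ω', ι (MvPolynomial (Fin n) F) (diff (g i)) * ω = g i • ω'
  set x := ι (MvPolynomial (Fin n) F) (diff (g i)) * ω with hx
  let P : MvPolynomial (Fin n) F := ∏ j ∈ Finset.univ.erase i, g j ^ a j
  have hsum := hω
  rw [diff_prod_pow, map_sum, Finset.sum_mul, ← Finset.add_sum_erase _ _ (Finset.mem_univ i)]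
    at hsum
  have hdiv : ∀ j ∈ Finset.univ.erase i, ∃ y : Forms F n,
      ι (MvPolynomial (Fin n) F) (logCoeff g a Finset.univ j • diff (g j)) * ω =
        g i ^ a i • y := by
    intro j hj
    have hij : i ∈ (Finset.univ : Finset (Fin t)).erase j := by
      simpa using (Finset.ne_of_mem_erase hj).symm
    rw [map_smul, smul_mul_assoc, logCoeff, ← Finset.mul_prod_erase _ _ hij, mul_left_comm,
      mul_smul]
    exact ⟨_, rfl⟩
  choose! y hy using hdiv
  rw [Finset.sum_congr rfl hy, ← Finset.smul_sum, map_smul, smul_mul_assoc, ← hx] at hsum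
  have h1 : g i ^ (a i - 1) • ((a i : MvPolynomial (Fin n) F) * P) • x =
      g i ^ (a i - 1) • g i • -∑ j ∈ Finset.univ.erase i, y j := by
    rw [smul_smul, smul_smul, ← pow_succ, Nat.sub_add_cancel (Nat.pos_of_ne_zero (H.a_ne i)),
      smul_neg, ← eq_neg_of_add_eq_zero_left hsum, logCoeff]
    congr 1
    ring
  have h2 := smul_right_injective (Forms F n) (pow_ne_zero (a i - 1) (H.g_ne i)) h1
  have hP : IsRelPrime P (g i) := by
    refine IsRelPrime.prod_left fun j hj => ?_
    exact (H.isRelPrime hn (Finset.ne_of_mem_erase hj)).pow_left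
  rw [mul_comm, mul_smul] at h2
  obtain ⟨w, hw⟩ := exists_eq_smul_of_isRelPrime (H.g_ne i) hP h2
  refine ⟨(C ((a i : F)⁻¹) : MvPolynomial (Fin n) F) • w, ?_⟩
  rw [smul_comm, ← hw, smul_smul, ← map_natCast (C : F →+* MvPolynomial (Fin n) F), ← map_mul,
    inv_mul_cancel₀ (H.cast_a i), map_one, one_smul]

lemma prod_smul_actVec_logVec (hn : 2 ≤ n) (ω : (H.logSystem hn).logForms Set.univ) :
    (∏ i, g i ^ a i) • ((H.logSystem hn).actVec (logVec F n a) ω : Forms F n) =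
      ι (MvPolynomial (Fin n) F) (diff (∏ i, g i ^ a i)) * ω := by
  rw [LogSystem.actVec_apply, diff_prod_pow, map_sum, Finset.sum_mul]
  simp only [logVec, map_zero, zero_mul, zero_add]
  rw [Finset.smul_sum]
  refine Finset.sum_congr rfl fun i _ => ?_
  have h := (H.logSystem hn).smul_res i ω
  rw [map_smul, smul_mul_assoc]
  change _ = _ • (ι (MvPolynomial (Fin n) F) ((H.logSystem hn).α i) * (ω : Forms F n))
  rw [← h, smul_smul, smul_smul]
  congr 1
  change _ = _ * g i
  rw [mul_comm _ (g i), mul_logCoeff g (Finset.mem_univ i) (H.a_ne i), mul_comm]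

/-- A form killed by the differential of the leading form is, up to a constant, the exterior
product of the logarithmic differential and of its contraction with the Euler vector field. -/
lemma smul_eq_actVec_contr (hn : 2 ≤ n) {ω : Forms F n}
    (hω : ι (MvPolynomial (Fin n) F) (diff (∏ i, g i ^ a i)) * ω = 0) :
    ∃ hc : contr (euler F n) ω ∈ (H.logSystem hn).logForms Set.univ,
      ((H.logSystem hn).actVec (logVec F n a) ⟨_, hc⟩ : Forms F n) =
        (δ : MvPolynomial (Fin n) F) • ω := by
  have hc : contr (euler F n) ω ∈ (H.logSystem hn).logForms Set.univ :=
    (H.logSystem hn).contr_mem_logForms (fun i _ => ⟨d i, by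
      rw [mul_comm]
      exact euler_diff (H.homogeneous i)⟩) (H.mem_logForms hn hω)
  refine ⟨hc, smul_right_injective (Forms F n) H.prod_ne ?_⟩
  change (∏ i, g i ^ a i) • _ = (∏ i, g i ^ a i) • _
  rw [H.prod_smul_actVec_logVec hn, ← smul_eq_contr_euler H.homogeneous_prod hω, smul_smul,
    mul_comm]

/-- The action on logarithmic forms of the exterior multiples of the logarithmic differential. -/
def logMap (hn : 2 ≤ n) : ExteriorAlgebra (MvPolynomial (Fin n) F)
    (KaehlerDifferential F (MvPolynomial (Fin n) F) × (Fin t → MvPolynomial (Fin n) F))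
      →ₗ[MvPolynomial (Fin n) F] Forms F n :=
  ((H.logSystem hn).logForms Set.univ).subtype ∘ₗ
    (LinearMap.applyₗ (H.logSystem hn).one) ∘ₗ (H.logSystem hn).act.toLinearMap ∘ₗ
      LinearMap.mulLeft _ (ι (MvPolynomial (Fin n) F) (logVec F n a))

lemma logMap_apply (hn : 2 ≤ n) (η : ExteriorAlgebra (MvPolynomial (Fin n) F)
    (KaehlerDifferential F (MvPolynomial (Fin n) F) × (Fin t → MvPolynomial (Fin n) F))) :
    H.logMap hn η = (H.logSystem hn).actVec (logVec F n a)
      ((H.logSystem hn).act η (H.logSystem hn).one) := by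
  rw [← LogSystem.act_ι_mul]
  rfl

lemma logMap_mem_kerDeg (hn : 2 ≤ n) {k : ℕ} {η : ExteriorAlgebra (MvPolynomial (Fin n) F)
    (KaehlerDifferential F (MvPolynomial (Fin n) F) × (Fin t → MvPolynomial (Fin n) F))}
    (hη : η ∈ extDeg (MvPolynomial (Fin n) F) _ k) :
    H.logMap hn η ∈ kerDeg (∏ i, g i ^ a i) (k + 1) := by
  rw [logMap_apply]
  refine ⟨LogSystem.actVec_mem_extDeg _ _ (LogSystem.act_one_mem_extDeg _ hη), ?_⟩
  rw [SetLike.mem_coe, LinearMap.mem_ker, LinearMap.mulLeft_apply, ← H.prod_smul_actVec_logVec hn,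
    ← Module.End.mul_apply, LogSystem.actVec_sq]
  simp

instance : Module.Free (MvPolynomial (Fin n) F)
    (KaehlerDifferential F (MvPolynomial (Fin n) F)) :=
  Module.Free.of_basis (KaehlerDifferential.mvPolynomialBasis F (Fin n))

instance : Module.Finite (MvPolynomial (Fin n) F)
    (KaehlerDifferential F (MvPolynomial (Fin n) F)) :=
  Module.Finite.of_basis (KaehlerDifferential.mvPolynomialBasis F (Fin n))

/-- An element of the kernel is torsion modulo the relations; the quotient is torsion-free near
every point but the origin, and the bound on its projective dimension removes the origin. -/
lemma logMap_eq_zero_iff (hn : 2 ≤ n) {k : ℕ} (hk : k ≤ n)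
    {η : ExteriorAlgebra (MvPolynomial (Fin n) F)
      (KaehlerDifferential F (MvPolynomial (Fin n) F) × (Fin t → MvPolynomial (Fin n) F))}
    (hη : η ∈ extDeg (MvPolynomial (Fin n) F) _ k) :
    H.logMap hn η = 0 ↔
      η ∈ vecIdeal (logVec F n a :: (List.finRange t).map (H.logSystem hn).rel) k := by
  constructor
  · intro h
    have hdual (x : Fin n → AlgebraicClosure F) (hx : x ≠ 0) := H.hasDualForms hn hx
    refine mem_of_pdLT_quotient ((pdLT_extDeg_quotient hdual k hk).mono hk) hη fun x hx => ?_
    -- The Euler form extended by e_i ↦ d_i: it sends dg_i - g_i e_i to d_i g_i - g_i d_i = 0 and ∑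
    -- a_i e_i to δ.
    let c : Module.Dual (MvPolynomial (Fin n) F)
        (KaehlerDifferential F (MvPolynomial (Fin n) F) × (Fin t → MvPolynomial (Fin n) F)) :=
      LinearMap.coprod (euler F n) (∑ i, (d i : MvPolynomial (Fin n) F) • LinearMap.proj i)
    have hcrel (i : Fin t) : c ((H.logSystem hn).rel i) = 0 := by
      simp only [c, LinearMap.coprod_apply, LogSystem.rel, logSystem, LinearMap.sum_apply,
        LinearMap.smul_apply, LinearMap.proj_apply, euler_diff (H.homogeneous i), smul_eq_mul]
      rw [Finset.sum_eq_single i (fun j _ hj => by simp [Pi.single_eq_of_ne hj]) (by simp),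
        Pi.single_eq_same]
      ring
    have hclog : c (logVec F n a) ≠ 0 := by
      have : c (logVec F n a) = C (δ : F) := by
        simp only [c, LinearMap.coprod_apply, logVec, LinearMap.sum_apply, map_zero, zero_add,
          LinearMap.smul_apply, LinearMap.proj_apply, smul_eq_mul, ← H.degree_eq]
        push_cast
        rw [map_sum]
        simp [mul_comm]
      rw [this]
      exact (map_ne_zero_iff _ (C_injective _ _)).2 H.cast_δ
    obtain ⟨r, hr, hrη⟩ := (H.logSystem hn).exists_smul_mem_of_act_ι_mul_eq_zero
      (List.mem_finRange) hcrel hclog hη (Subtype.ext h)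
    exact exists_smul_mem_vecIdeal (hdual x hx) hr hη hrη
  · intro h
    obtain ⟨ζ, hζ, y, hy, rfl⟩ := mem_vecIdeal_cons.1 h
    rw [map_add, logMap_apply, logMap_apply, LogSystem.act_eq_zero_of_mem _ hy,
      LogSystem.act_ι_mul, ← Module.End.mul_apply, LogSystem.actVec_sq]
    simp

lemma pdLT_map_logMap (hn : 2 ≤ n) {k : ℕ} (hk : k ≤ n) :
    PdLT (MvPolynomial (Fin n) F)
      (((extDeg (MvPolynomial (Fin n) F) _ k).map (H.logMap hn) : Submodule _ (Forms F n)) ⧸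
        (⊥ : Submodule _ (Forms F n)).submoduleOf
          ((extDeg (MvPolynomial (Fin n) F) _ k).map (H.logMap hn))) k :=
  PdLT.of_map (H.logMap hn) (by rw [sup_bot_eq])
    (fun η hη => by rw [Submodule.mem_bot]; exact H.logMap_eq_zero_iff hn hk hη)
    (pdLT_extDeg_quotient (fun x hx => H.hasDualForms hn hx) k hk)

/-- Locally the logarithmic form θω is generated by ∏ g_i, and δω is its product with dΦ/Φ. -/
lemma exists_smul_mem_map_logMap (hn : 2 ≤ n) {k : ℕ} {ω : Forms F n}
    (hω : ω ∈ kerDeg (∏ i, g i ^ a i) (k + 1)) :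
    AwayFromOrigin fun s : MvPolynomial (Fin n) F =>
      s • ω ∈ (extDeg (MvPolynomial (Fin n) F) _ k).map (H.logMap hn) := by
  classical
  intro x hx
  obtain ⟨hωk, hω0⟩ := mem_kerDeg.1 hω
  obtain ⟨hc, hact⟩ := H.smul_eq_actVec_contr hn hω0
  let S : Finset (Fin t) := Finset.univ.filter fun i => aeval x (g i) = 0
  have hex (i : Fin t) : ∃ c : Module.Dual (MvPolynomial (Fin n) F)
        (KaehlerDifferential F (MvPolynomial (Fin n) F)), i ∈ S →
      (∀ j ∈ S, j ≠ i → c (diff (g j)) = 0) ∧ aeval x (c (diff (g i))) ≠ 0 := by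
    by_cases hi : i ∈ S
    · obtain ⟨c, hc⟩ := H.exists_dual_smooth hx (S := S) (by simp [S]) hi
      exact ⟨c, fun _ => hc⟩
    · exact ⟨0, fun h => absurd h hi⟩
  choose c hc' using hex
  obtain ⟨η, hη, h⟩ := (H.logSystem hn).exists_act_eq_smul (S := S) (c := c)
    (fun i hi j hj hji => (hc' i hi).1 j hj hji) subset_rfl (contr_mem (euler F n) hωk)
    (fun i _ => hc i (Set.mem_univ i))
  set s : MvPolynomial (Fin n) F := (∏ i ∈ Sᶜ, (H.logSystem hn).f i) *
    ∏ i ∈ S, c i ((H.logSystem hn).α i) with hs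
  refine ⟨s * C (δ : F), ?_, η, hη, ?_⟩
  · rw [map_mul, hs, map_mul, map_prod, map_prod]
    refine mul_ne_zero (mul_ne_zero ?_ ?_) ?_
    · refine Finset.prod_ne_zero_iff.2 fun i hi => ?_
      change aeval x (g i) ≠ 0
      simpa [S] using hi
    · exact Finset.prod_ne_zero_iff.2 fun i hi => (hc' i hi).2
    · rw [algHom_C]
      exact (map_ne_zero _).2 H.cast_δ
  · have h1 : (H.logSystem hn).act η (H.logSystem hn).one =
        s • (⟨_, hc⟩ : (H.logSystem hn).logForms Set.univ) := Subtype.ext h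
    rw [logMap_apply, h1, map_smul, Submodule.coe_smul, hact, smul_smul, map_natCast]

lemma kerDeg_eq_map (hn : 2 ≤ n) {k : ℕ} (hk : k + 1 ≤ n) :
    kerDeg (∏ i, g i ^ a i) (k + 1) =
      (extDeg (MvPolynomial (Fin n) F) _ k).map (H.logMap hn) := by
  have hle : (extDeg (MvPolynomial (Fin n) F) _ k).map (H.logMap hn) ≤
      kerDeg (∏ i, g i ^ a i) (k + 1) := by
    rintro _ ⟨η, hη, rfl⟩
    exact H.logMap_mem_kerDeg hn hη
  refine le_antisymm (fun ω hω => ?_) hle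
  have hpd := PdLT.of_subquotients bot_le (hle.trans inf_le_left)
    (H.pdLT_map_logMap hn (by omega)) (pdLT_extDeg_quotient (l := []) (fun _ _ => trivial) (k + 1) hk)
  exact mem_of_pdLT_quotient (hpd.mono hk) hω.1 (H.exists_smul_mem_map_logMap hn hω)

lemma kerDeg_one : kerDeg (∏ i, g i ^ a i) 1 = (⊥ : Submodule (MvPolynomial (Fin n) F) _) := by
  rw [eq_bot_iff]
  intro ω hω
  obtain ⟨hωk, hω0⟩ := mem_kerDeg.1 hω
  have h1 : contr (euler F n) ω = 0 := by
    have h := contr_mem (euler F n) hωk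
    rwa [Nat.sub_self, extDeg, Submodule.mem_bot] at h
  have h2 := smul_eq_contr_euler H.homogeneous_prod hω0
  rw [h1, mul_zero] at h2
  refine (smul_eq_zero.1 h2).resolve_left (mul_ne_zero ?_ H.prod_ne)
  rw [← map_natCast (C : F →+* MvPolynomial (Fin n) F)]
  exact (map_ne_zero_iff _ (C_injective _ _)).2 H.cast_δ

/-- The bound is one better than that for the ambient exterior power, because `logMap` raises the
degree by one. For n ≤ 1, where coprimality of the g_i is not available, only functions occur and
none is killed. -/
lemma pdLT_kerDeg {k : ℕ} (hk : k + 1 ≤ n) :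
    PdLT (MvPolynomial (Fin n) F) (kerDeg (∏ i, g i ^ a i) (k + 1) ⧸
      (⊥ : Submodule (MvPolynomial (Fin n) F) (Forms F n)).submoduleOf
        (kerDeg (∏ i, g i ^ a i) (k + 1))) k := by
  by_cases hn : 2 ≤ n
  · rw [H.kerDeg_eq_map hn hk]
    exact H.pdLT_map_logMap hn (by omega)
  · obtain rfl : k = 0 := by omega
    rw [zero_add, H.kerDeg_one]
    have : Subsingleton ((⊥ : Submodule (MvPolynomial (Fin n) F) (Forms F n)) ⧸
        (⊥ : Submodule (MvPolynomial (Fin n) F) (Forms F n)).submoduleOf ⊥) :=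
      (Submodule.mkQ_surjective _).subsingleton
    exact PdLT.of_subsingleton 0

end IsAdmissible

/-! ### Exactness of multiplication by dG on cohomology -/

namespace IsAdmissible

variable {F : Type u} [Field F] {n t : ℕ} {G : MvPolynomial (Fin n) F}
    {g : Fin t → MvPolynomial (Fin n) F} {a d : Fin t → ℕ} {δ δ' : ℕ}
    (H : IsAdmissible G g a d δ δ')

include H

/-- At a point other than the origin, there is a vector field along which the derivative of the
leading form does not vanish, or which kills the leading form but not `G`. -/
lemma exists_vectorField {x : Fin n → AlgebraicClosure F} (hx : x ≠ 0) :
    ∃ c : Module.Dual (MvPolynomial (Fin n) F) (KaehlerDifferential F (MvPolynomial (Fin n) F)),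
      aeval x (c (diff (∏ i, g i ^ a i))) ≠ 0 ∨
        c (diff (∏ i, g i ^ a i)) = 0 ∧ aeval x (c (diff G)) ≠ 0 := by
  classical
  let S : Finset (Fin t) := Finset.univ.filter fun i => aeval x (g i) = 0
  have hS : ∀ i, i ∈ S ↔ aeval x (g i) = 0 := by simp [S]
  have hRx (T : Finset (Fin t)) (hT : Disjoint T S) : aeval x (∏ i ∈ T, g i ^ a i) ≠ 0 := by
    rw [map_prod]
    refine Finset.prod_ne_zero_iff.2 fun i hi => ?_
    rw [map_pow]
    exact pow_ne_zero _ fun h => Finset.disjoint_left.1 hT hi ((hS i).2 h)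
  -- This separates the points where the second smoothness hypothesis is in force from those where
  -- dΦ(x) ≠ 0: no g_i vanishes at x, or exactly one does, with exponent 1.
  by_cases hbig : 2 ≤ S.card ∨ ∃ i, S = {i} ∧ 1 < a i
  · obtain ⟨i, hi⟩ : S.Nonempty := by
      rcases hbig with h | ⟨i, h, -⟩
      · exact Finset.card_pos.1 (by omega)
      · exact h ▸ Finset.singleton_nonempty i
    have hind := H.linearIndependent_option hbig hx fun i hi => (hS i).1 hi
    have hdual := exists_dual_ne_zero (KaehlerDifferential.mvPolynomialBasis F (Fin n)) x
      (v := fun o : Option S => diff (o.elim G fun i => g i)) (by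
        simpa only [KaehlerDifferential.mvPolynomialBasis_repr_apply] using hind)
    obtain ⟨c₀, hc₀, hc₀G⟩ := hdual none
    obtain ⟨c₁, hc₁, hc₁i⟩ := hdual (some ⟨i, hi⟩)
    have hc₀g : ∀ j ∈ S, c₀ (diff (g j)) = 0 := fun j hj => hc₀ (some ⟨j, hj⟩) (by simp)
    have hc₁g : ∀ j ∈ S, j ≠ i → c₁ (diff (g j)) = 0 := fun j hj hji =>
      hc₁ (some ⟨j, hj⟩) (by simpa using hji)
    have hc₁G : c₁ (diff G) = 0 := hc₁ none (by simp)
    -- Φ = P g_i R with R nonzero at x.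
    let P := g i ^ (a i - 1) * ∏ j ∈ S.erase i, g j ^ a j
    let R := ∏ j ∈ Sᶜ, g j ^ a j
    have hP : ∏ j ∈ S, g j ^ a j = P * g i := by
      rw [← Finset.mul_prod_erase S _ hi, ← Nat.sub_add_cancel (Nat.pos_of_ne_zero (H.a_ne i)),
        pow_succ]
      simp only [P]
      ring
    have hD (c : Module.Dual (MvPolynomial (Fin n) F)
        (KaehlerDifferential F (MvPolynomial (Fin n) F))) : c (diff (∏ i, g i ^ a i)) =
          P * g i * c (diff R) + R * ∑ j ∈ S, logCoeff g a S j * c (diff (g j)) := by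
      rw [← Finset.prod_mul_prod_compl S, diff, Derivation.leibniz, map_add, map_smul, map_smul,
        hP, ← hP]
      change _ + R • c (diff (∏ j ∈ S, g j ^ a j)) = _
      rw [diff_prod_pow, map_sum, hP]
      simp only [map_smul, smul_eq_mul]
      rfl
    have h₀ : c₀ (diff (∏ i, g i ^ a i)) = P * g i * c₀ (diff R) := by
      rw [hD, Finset.sum_eq_zero fun j hj => by rw [hc₀g j hj, mul_zero], mul_zero, add_zero]
    let u := g i * c₁ (diff R) + R * a i * c₁ (diff (g i))
    have h₁ : c₁ (diff (∏ i, g i ^ a i)) = P * u := by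
      rw [hD, Finset.sum_eq_single i (fun j hj hji => by rw [hc₁g j hj hji, mul_zero])
        (fun h => absurd hi h)]
      simp only [logCoeff, P, u]
      ring
    -- Both derivatives of Φ are multiples of P, so this combination kills Φ identically. As g_i(x)
    -- = 0, u reduces at x to R a_i c₁(dg_i), which is nonzero.
    refine ⟨u • c₀ - (g i * c₀ (diff R)) • c₁, Or.inr ⟨?_, ?_⟩⟩
    · rw [LinearMap.sub_apply, LinearMap.smul_apply, LinearMap.smul_apply, h₀, h₁, smul_eq_mul,
        smul_eq_mul]
      ring
    · rw [LinearMap.sub_apply, LinearMap.smul_apply, LinearMap.smul_apply, hc₁G, smul_zero,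
        sub_zero, smul_eq_mul, map_mul]
      refine mul_ne_zero ?_ hc₀G
      simp only [u, map_add, map_mul, (hS i).1 hi, zero_mul, zero_add, map_natCast]
      exact mul_ne_zero (mul_ne_zero (hRx _ (disjoint_compl_left))
        (natCast_algebraicClosure_ne_zero (H.cast_a i))) hc₁i
  · rw [not_or, not_le] at hbig
    rcases S.eq_empty_or_nonempty with hS0 | ⟨i, hi⟩
    · refine ⟨euler F n, Or.inl ?_⟩
      rw [euler_diff H.homogeneous_prod, map_mul, map_natCast]
      exact mul_ne_zero (natCast_algebraicClosure_ne_zero H.cast_δ) (hRx _ (by simp [hS0]))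
    · have hSi : S = {i} := by
        obtain ⟨j, hj⟩ := Finset.card_eq_one.1 (by
          have := Finset.card_pos.2 ⟨i, hi⟩
          omega : S.card = 1)
        rw [hj] at hi ⊢
        rw [Finset.mem_singleton.1 hi]
      have hai : a i = 1 := by
        have h1 := H.a_ne i
        have h2 : ¬1 < a i := fun h => hbig.2 ⟨i, hSi, h⟩
        omega
      obtain ⟨c, -, hc⟩ := H.exists_dual_smooth hx (fun j hj => (hS j).1 hj) hi
      refine ⟨c, Or.inl ?_⟩
      rw [diff_prod_pow, map_sum, map_sum, Finset.sum_eq_single i]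
      · rw [map_smul, smul_eq_mul, map_mul, logCoeff, hai]
        simp only [Nat.cast_one, Nat.sub_self, pow_zero, one_mul]
        exact mul_ne_zero (hRx _ (by simp [hSi])) hc
      · intro j _ hji
        have hij : i ∈ (Finset.univ : Finset (Fin t)).erase j := by simpa using hji.symm
        rw [map_smul, smul_eq_mul, map_mul, logCoeff, ← Finset.mul_prod_erase _ _ hij, hai]
        simp [(hS i).1 hi]
      · simp

/-- For a vector field c as in `exists_vectorField`: if c(dΦ) ≠ 0 at x, then c(dΦ)ω = dΦ∧c(ω). If
c(dΦ) = 0, contraction preserves the kernel of dΦ∧ and the multiples of dΦ, and c(dG)ω = dG∧c(ω) +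
c(dG∧ω). -/
lemma exists_smul_mem_of_mul_mem {k : ℕ} {ω : Forms F n}
    (hω : ω ∈ kerDeg (∏ i, g i ^ a i) (k + 1))
    (hG : ι (MvPolynomial (Fin n) F) (diff G) * ω ∈ imDeg (∏ i, g i ^ a i) (k + 2)) :
    AwayFromOrigin fun s : MvPolynomial (Fin n) F => s • ω ∈ (kerDeg (∏ i, g i ^ a i) k).map
      (LinearMap.mulLeft (MvPolynomial (Fin n) F) (ι (MvPolynomial (Fin n) F) (diff G))) ⊔
        imDeg (∏ i, g i ^ a i) (k + 1) := by
  intro x hx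
  obtain ⟨hωk, hω0⟩ := mem_kerDeg.1 hω
  obtain ⟨c, hc | ⟨hc0, hcG⟩⟩ := H.exists_vectorField hx
  · refine ⟨_, hc, Submodule.mem_sup_right ⟨contr c ω, contr_mem c hωk, ?_⟩⟩
    have h := contr_ι_mul c (diff (∏ i, g i ^ a i)) ω
    rw [hω0, map_zero] at h
    exact (sub_eq_zero.1 h.symm).symm
  · obtain ⟨ξ, hξ, hξG⟩ := hG
    have h1 := contr_ι_mul c (diff (∏ i, g i ^ a i)) ω
    rw [hω0, hc0, map_zero, zero_smul, zero_sub, eq_comm, neg_eq_zero] at h1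
    have h2 := contr_ι_mul c (diff G) ω
    rw [← hξG, LinearMap.mulLeft_apply, contr_ι_mul, hc0, zero_smul, zero_sub] at h2
    refine ⟨_, hcG, Submodule.mem_sup.2 ⟨_, ⟨contr c ω, ⟨contr_mem c hωk, h1⟩, rfl⟩, _,
      ⟨-contr c ξ, neg_mem (contr_mem c hξ), rfl⟩, ?_⟩⟩
    rw [LinearMap.mulLeft_apply, LinearMap.mulLeft_apply, mul_neg, h2]
    abel

/-- The forms dΦ∧η are the quotient of the previous exterior power by its kernel, so the bound on
kernels is used twice, at two consecutive indices. -/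
lemma pdLT_kerDeg_quotient {k : ℕ} (hk : k ≤ n) :
    PdLT (MvPolynomial (Fin n) F) (kerDeg (∏ i, g i ^ a i) k ⧸
      (imDeg (∏ i, g i ^ a i) k).submoduleOf (kerDeg (∏ i, g i ^ a i) k)) k := by
  have hbot (k : ℕ) (hk : k ≤ n) :=
    pdLT_extDeg_quotient (F := F) (n := n) (W := KaehlerDifferential F (MvPolynomial (Fin n) F))
      (l := []) (fun _ _ => trivial) k hk
  have hsub (Y : Submodule (MvPolynomial (Fin n) F) (Forms F n))
      (X : Submodule (MvPolynomial (Fin n) F) (Forms F n)) 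
      (hX : X ≤ extDeg (MvPolynomial (Fin n) F) (KaehlerDifferential F (MvPolynomial (Fin n) F)) 0) :
      PdLT (MvPolynomial (Fin n) F) (X ⧸ Y.submoduleOf X) 0 := by
    have : Subsingleton X := by rw [le_bot_iff.1 hX]; infer_instance
    have : Subsingleton (X ⧸ Y.submoduleOf X) := (Submodule.mkQ_surjective _).subsingleton
    exact PdLT.of_subsingleton 0
  cases k with
  | zero => exact hsub _ _ inf_le_left
  | succ k =>
    refine PdLT.of_subquotients bot_le (imDeg_le_kerDeg _) ?_
      ((H.pdLT_kerDeg hk).mono (Nat.le_succ k))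
    refine PdLT.of_map (X := extDeg (MvPolynomial (Fin n) F)
      (KaehlerDifferential F (MvPolynomial (Fin n) F)) k) (B := kerDeg (∏ i, g i ^ a i) k)
      (LinearMap.mulLeft (MvPolynomial (Fin n) F) (ι (MvPolynomial (Fin n) F) (diff (∏ i, g i ^ a i)))) (by rw [sup_bot_eq]; rfl)
      (fun ω hω => ?_) ?_
    · rw [Submodule.mem_bot, mem_kerDeg]
      exact ⟨fun h => ⟨hω, h⟩, fun h => h.2⟩
    · cases k with
      | zero => exact hsub _ _ le_rfl
      | succ k =>
        exact PdLT.of_subquotients bot_le inf_le_left (H.pdLT_kerDeg (by omega))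
          (hbot (k + 1) (by omega))

/-- Exterior multiplication by `dG` is exact in degrees `< n` on the cohomology of the exterior
multiplication by the differential of the leading form. -/
theorem mem_of_mul_mem {k : ℕ} (hk : k + 1 ≤ n) {ω : Forms F n}
    (hω : ω ∈ kerDeg (∏ i, g i ^ a i) (k + 1))
    (hG : ι (MvPolynomial (Fin n) F) (diff G) * ω ∈ imDeg (∏ i, g i ^ a i) (k + 2)) :
    ω ∈ (kerDeg (∏ i, g i ^ a i) k).map
      (LinearMap.mulLeft (MvPolynomial (Fin n) F) (ι (MvPolynomial (Fin n) F) (diff G))) ⊔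
        imDeg (∏ i, g i ^ a i) (k + 1) := by
  refine (acyclic_of_awayFromOrigin
    (LinearMap.mulLeft (MvPolynomial (Fin n) F) (ι (MvPolynomial (Fin n) F) (diff G)))
    (kerDeg (∏ i, g i ^ a i)) (imDeg (∏ i, g i ^ a i)) ?_ imDeg_le_kerDeg ?_ ?_ ?_
    (fun k hk => H.pdLT_kerDeg_quotient hk)
    (fun k _ ω hω hG => H.exists_smul_mem_of_mul_mem hω hG) k hk).1 ω hω hG
  · exact le_bot_iff.1 inf_le_left
  · rintro k _ ⟨η, hη, rfl⟩
    obtain ⟨hηk, hη0⟩ := mem_kerDeg.1 hη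
    refine mem_kerDeg.2 ⟨ι_mul_mem _ hηk, ?_⟩
    rw [LinearMap.mulLeft_apply, ι_mul_ι_mul_swap, hη0, mul_zero, neg_zero]
  · rintro k _ ⟨_, ⟨η, hη, rfl⟩, rfl⟩
    rw [LinearMap.mulLeft_apply, LinearMap.mulLeft_apply, ι_mul_ι_mul_swap]
    cases k with
    | zero =>
      rw [SetLike.mem_coe, Nat.zero_sub, extDeg, Submodule.mem_bot] at hη
      simp [hη]
    | succ k =>
      exact ⟨-(ι _ (diff G) * η), neg_mem (ι_mul_mem _ hη), by
        rw [LinearMap.mulLeft_apply, mul_neg]⟩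
  · intro k ω _
    rw [LinearMap.mulLeft_apply, LinearMap.mulLeft_apply, ι_mul_ι_mul_self]
    exact zero_mem _

end IsAdmissible

/-! ### Homogeneous components of forms -/

section Components

variable (F : Type u) [Field F] (n : ℕ)

/-- The basis of the algebra of forms given by the exterior products of the `dx_i`. -/
def formsBasis : Module.Basis (Finset (Fin n)) (MvPolynomial (Fin n) F) (Forms F n) :=
  (KaehlerDifferential.mvPolynomialBasis F (Fin n)).ExteriorAlgebra

lemma formsBasis_ofFinEmb {j : ℕ} (i : Fin j ↪o Fin n) :
    formsBasis F n (Set.powersetCard.ofFinEmbEquiv i) =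
      ExteriorAlgebra.ιMulti (MvPolynomial (Fin n) F) j fun t => diff (F := F) (X (i t)) := by
  rw [formsBasis, ExteriorAlgebra.basis_apply_powersetCard, ExteriorAlgebra.ιMulti_family,
    Equiv.symm_apply_apply]
  congr 1
  ext t
  simp

lemma homForms_eq_span (k : ℤ) (m : ℕ) : homForms F n k m = Submodule.span F
    {ω | ∃ (s : Finset (Fin n)) (g : MvPolynomial (Fin n) F),
      (s.card : ℤ) = k ∧ g.IsHomogeneous m ∧ ω = g • formsBasis F n s} := by
  refine le_antisymm (Submodule.span_mono ?_) (Submodule.span_mono ?_)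
  · rintro _ ⟨j, i, g, hj, hg, rfl⟩
    refine ⟨_, g, ?_, hg, by rw [← formsBasis_ofFinEmb]⟩
    rw [Set.powersetCard.card_eq, hj]
  · rintro _ ⟨s, g, hs, hg, rfl⟩
    refine ⟨s.card, Set.powersetCard.ofFinEmbEquiv.symm (Set.powersetCard.ofCard rfl), g, hs, hg, ?_⟩
    rw [← formsBasis_ofFinEmb, Equiv.apply_symm_apply, Set.powersetCard.val_ofCard]

variable {F n}

lemma formsBasis_mem_extDeg (s : Finset (Fin n)) :
    formsBasis F n s ∈ extDeg (MvPolynomial (Fin n) F)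
      (KaehlerDifferential F (MvPolynomial (Fin n) F)) (s.card + 1) := by
  have h := ExteriorAlgebra.basis_eq_coe_basis
    (KaehlerDifferential.mvPolynomialBasis F (Fin n)) (Set.powersetCard.ofCard (s := s) rfl)
  rw [Set.powersetCard.val_ofCard] at h
  rw [formsBasis, h]
  exact Subtype.prop _

lemma formsBasis_induction {p : Forms F n → Prop} {k : ℕ} {ω : Forms F n}
    (hω : ω ∈ extDeg (MvPolynomial (Fin n) F) (KaehlerDifferential F (MvPolynomial (Fin n) F)) k)
    (zero : p 0) (add : ∀ ω η, p ω → p η → p (ω + η))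
    (smul : ∀ (s : Finset (Fin n)) (g : MvPolynomial (Fin n) F), s.card + 1 = k →
      p (g • formsBasis F n s)) : p ω := by
  cases k with
  | zero =>
    rw [extDeg, Submodule.mem_bot] at hω
    rwa [hω]
  | succ k =>
    have h := congrArg Subtype.val (((KaehlerDifferential.mvPolynomialBasis F
      (Fin n)).exteriorPower k).sum_repr ⟨ω, hω⟩)
    rw [Submodule.coe_sum] at h
    change _ = ω at h
    rw [← h]
    refine Finset.sum_induction _ p add zero fun s _ => ?_
    rw [Submodule.coe_smul, ← ExteriorAlgebra.basis_eq_coe_basis]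
    exact smul _ _ (by rw [Set.powersetCard.card_eq])

lemma forms_induction {p : Forms F n → Prop} (ω : Forms F n)
    (zero : p 0) (add : ∀ ω η, p ω → p η → p (ω + η))
    (smul : ∀ (s : Finset (Fin n)) (g : MvPolynomial (Fin n) F) (m : ℕ), g.IsHomogeneous m →
      p (g • formsBasis F n s)) : p ω := by
  rw [← (formsBasis F n).sum_repr ω]
  refine Finset.sum_induction _ p add zero fun s _ => ?_
  rw [← sum_homogeneousComponent ((formsBasis F n).repr ω s), Finset.sum_smul]
  exact Finset.sum_induction _ p add zero fun m _ =>
    smul _ _ m (homogeneousComponent_isHomogeneous m _)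

/-- The homogeneous component of degree `l` of a polynomial, zero if `l < 0`. -/
def polyComp (l : ℤ) : MvPolynomial (Fin n) F →ₗ[F] MvPolynomial (Fin n) F :=
  if 0 ≤ l then homogeneousComponent l.toNat else 0

lemma polyComp_of_isHomogeneous {g : MvPolynomial (Fin n) F} {m : ℕ} (hg : g.IsHomogeneous m)
    (l : ℤ) : polyComp l g = if l = m then g else 0 := by
  rw [polyComp]
  split_ifs with h h' h'
  · rw [homogeneousComponent_of_mem hg, if_pos (by omega)]
  · rw [homogeneousComponent_of_mem hg, if_neg (by omega)]
  · omega
  · rfl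

lemma polyComp_isHomogeneous (l : ℤ) (g : MvPolynomial (Fin n) F) :
    (polyComp l g).IsHomogeneous l.toNat := by
  rw [polyComp]
  split_ifs
  · exact homogeneousComponent_isHomogeneous _ _
  · exact isHomogeneous_zero _ _ _

/-- The part of a form whose coefficients are homogeneous of degree `l`. -/
def coeffComp (l : ℤ) : Forms F n →ₗ[F] Forms F n :=
  ∑ s, ((LinearMap.toSpanSingleton (MvPolynomial (Fin n) F) _ (formsBasis F n s)).restrictScalars F)
    ∘ₗ polyComp l ∘ₗ (((formsBasis F n).coord s).restrictScalars F)

lemma coeffComp_smul_formsBasis (l : ℤ) (g : MvPolynomial (Fin n) F) (s : Finset (Fin n)) :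
    coeffComp l (g • formsBasis F n s) = polyComp l g • formsBasis F n s := by
  classical
  rw [coeffComp, LinearMap.sum_apply, Finset.sum_eq_single s]
  · simp
  · intro s' _ hs
    simp [hs.symm]
  · simp

lemma coeffComp_smul_formsBasis_of_isHomogeneous (l : ℤ) {g : MvPolynomial (Fin n) F} {m : ℕ}
    (hg : g.IsHomogeneous m) (s : Finset (Fin n)) :
    coeffComp l (g • formsBasis F n s) = if l = m then g • formsBasis F n s else 0 := by
  rw [coeffComp_smul_formsBasis, polyComp_of_isHomogeneous hg]
  split_ifs <;> simp

lemma coeffComp_coeffComp (l m : ℤ) (ω : Forms F n) :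
    coeffComp l (coeffComp m ω) = if l = m then coeffComp m ω else 0 := by
  induction ω using forms_induction with
  | zero => simp
  | add ω η hω hη =>
    rw [map_add, map_add, hω, hη]
    split_ifs <;> simp
  | smul s g d hg =>
    rw [coeffComp_smul_formsBasis_of_isHomogeneous m hg]
    by_cases hm : m = d
    · rw [if_pos hm, coeffComp_smul_formsBasis_of_isHomogeneous l hg, hm]
    · simp [hm]

lemma coeffComp_of_mem_homForms (l : ℤ) {k : ℤ} {m : ℕ} {ω : Forms F n} (hω : ω ∈ homForms F n k m) :
    coeffComp l ω = if l = m then ω else 0 := by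
  rw [homForms_eq_span] at hω
  induction hω using Submodule.span_induction with
  | mem ω h =>
    obtain ⟨s, g, -, hg, rfl⟩ := h
    exact coeffComp_smul_formsBasis_of_isHomogeneous l hg s
  | zero => simp
  | add ω η _ _ hω hη =>
    rw [map_add, hω, hη]
    split_ifs <;> simp
  | smul c ω _ hω =>
    rw [map_smul, hω]
    split_ifs <;> simp

lemma mem_extDeg_of_mem_homForms {k : ℕ} {m : ℕ} {ω : Forms F n} (hω : ω ∈ homForms F n ((k : ℤ) - 1) m) :
    ω ∈ extDeg (MvPolynomial (Fin n) F) (KaehlerDifferential F (MvPolynomial (Fin n) F)) k := by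
  rw [homForms_eq_span] at hω
  induction hω using Submodule.span_induction with
  | mem ω h =>
    obtain ⟨s, g, hs, hg, rfl⟩ := h
    obtain rfl : s.card + 1 = k := by omega
    exact Submodule.smul_mem _ _ (formsBasis_mem_extDeg s)
  | zero => exact zero_mem _
  | add ω η _ _ hω hη => exact add_mem hω hη
  | smul c ω _ hω => exact Submodule.smul_of_tower_mem _ c hω

lemma homForms_eq_bot {k : ℤ} (hk : k < 0 ∨ n < k) (m : ℕ) : homForms F n k m = ⊥ := by
  rw [homForms_eq_span, Submodule.span_eq_bot]
  rintro _ ⟨s, g, hs, -, -⟩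
  have := s.card_le_univ
  rw [Fintype.card_fin] at this
  omega

lemma coeffComp_mem_homForms (l : ℤ) {k : ℕ} {ω : Forms F n}
    (hω : ω ∈ extDeg (MvPolynomial (Fin n) F) (KaehlerDifferential F (MvPolynomial (Fin n) F)) k) :
    coeffComp l ω ∈ homForms F n ((k : ℤ) - 1) l.toNat := by
  refine formsBasis_induction (p := fun ω => coeffComp l ω ∈ homForms F n ((k : ℤ) - 1) l.toNat) hω
    (by simp) (fun ω η hω hη => ?_) (fun s g hs => ?_)
  · rw [map_add]
    exact add_mem hω hη
  · rw [coeffComp_smul_formsBasis, homForms_eq_span]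
    exact Submodule.subset_span ⟨s, _, by omega, polyComp_isHomogeneous l g, rfl⟩

lemma exists_sum_coeffComp (ω : Forms F n) :
    ∃ N : ℕ, ∀ M ≥ N, ∑ l ∈ Finset.range M, coeffComp (l : ℤ) ω = ω := by
  induction ω using forms_induction with
  | zero => exact ⟨0, by simp⟩
  | add ω η hω hη =>
    obtain ⟨N, hN⟩ := hω
    obtain ⟨N', hN'⟩ := hη
    refine ⟨max N N', fun M hM => ?_⟩
    simp only [map_add]
    rw [Finset.sum_add_distrib, hN M (le_of_max_le_left hM), hN' M (le_of_max_le_right hM)]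
  | smul s g d hg =>
    refine ⟨d + 1, fun M hM => ?_⟩
    simp only [coeffComp_smul_formsBasis_of_isHomogeneous _ hg, Int.natCast_inj]
    rw [Finset.sum_ite_eq', if_pos (Finset.mem_range.2 hM)]

end Components

/-! ### Exterior multiplication and the grading -/

section Wedge

variable {F : Type u} [Field F] {n : ℕ}

lemma dform_X (i : Fin n) : dform (X i : MvPolynomial (Fin n) F) = formsBasis F n {i} := by
  have h := ExteriorAlgebra.basis_apply_ofCard
    (KaehlerDifferential.mvPolynomialBasis F (Fin n)) (Finset.card_singleton i)
  rw [formsBasis, h, ExteriorAlgebra.ιMulti_family, ExteriorAlgebra.ιMulti_succ_apply,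
    ExteriorAlgebra.ιMulti_zero_apply, mul_one, Function.comp_apply,
    KaehlerDifferential.mvPolynomialBasis_apply, dform]
  have hi : Set.powersetCard.ofFinEmbEquiv.symm
      (Set.powersetCard.ofCard (Finset.card_singleton i)) 0 ∈ ({i} : Finset (Fin n)) :=
    (Set.powersetCard.mem_range_ofFinEmbEquiv_symm_iff_mem
      (Set.powersetCard.ofCard (Finset.card_singleton i)) _).1 ⟨0, rfl⟩
  rw [Finset.mem_singleton.1 hi]

lemma dform_X_mul_formsBasis (i : Fin n) (s : Finset (Fin n)) :
    ∃ (c : ℤ) (s' : Finset (Fin n)),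
      dform (X i : MvPolynomial (Fin n) F) * formsBasis F n s = c • formsBasis F n s' := by
  rw [dform_X]
  let b := KaehlerDifferential.mvPolynomialBasis F (Fin n)
  let s₁ : Set.powersetCard (Fin n) 1 := Set.powersetCard.ofCard (Finset.card_singleton i)
  let s₂ : Set.powersetCard (Fin n) s.card := Set.powersetCard.ofCard rfl
  change ∃ (c : ℤ) (s' : Finset (Fin n)),
    b.ExteriorAlgebra s₁ * b.ExteriorAlgebra s₂ = c • b.ExteriorAlgebra s'
  by_cases h : Disjoint s₁.val s₂.val
  · exact ⟨_, _, ExteriorAlgebra.basis_mul_of_disjoint b s₁ s₂ h⟩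
  · exact ⟨0, ∅, by rw [ExteriorAlgebra.basis_mul_of_not_disjoint b s₁ s₂ h, zero_smul]⟩

lemma diff_eq_sum (p : MvPolynomial (Fin n) F) :
    diff p = ∑ i, pderiv i p • diff (X i : MvPolynomial (Fin n) F) := by
  rw [← (KaehlerDifferential.mvPolynomialBasis F (Fin n)).sum_repr (diff p)]
  simp [KaehlerDifferential.mvPolynomialBasis_repr_apply]

lemma dform_mul_eq_sum (p : MvPolynomial (Fin n) F) (ω : Forms F n) :
    dform p * ω = ∑ i, pderiv i p • (dform (X i : MvPolynomial (Fin n) F) * ω) := by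
  rw [dform, ← diff, diff_eq_sum, map_sum, Finset.sum_mul]
  simp [dform]

lemma coeffComp_dform_mul {p : MvPolynomial (Fin n) F} {e : ℕ} (hp : p.IsHomogeneous e) (l : ℤ)
    (ω : Forms F n) : coeffComp l (dform p * ω) = dform p * coeffComp (l + 1 - e) ω := by
  -- For e = 0 the truncated degree e - 1 of the partial derivatives would give a wrong shift, but
  -- then dp = 0.
  rcases e.eq_zero_or_pos with rfl | he
  · have h : p = algebraMap F _ (coeff 0 p) := totalDegree_eq_zero_iff_eq_C.1 (by
      simpa using hp.totalDegree_le)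
    rw [dform, h, Derivation.map_algebraMap, map_zero, zero_mul, map_zero, zero_mul]
  induction ω using forms_induction with
  | zero => simp
  | add ω η hω hη => rw [mul_add, map_add, hω, hη, map_add, mul_add]
  | smul s g m hg =>
    have key (i : Fin n) : coeffComp l (pderiv i p • (dform (X i : MvPolynomial (Fin n) F) *
        (g • formsBasis F n s))) = if l + 1 - e = m then pderiv i p •
          (dform (X i : MvPolynomial (Fin n) F) * (g • formsBasis F n s)) else 0 := by
      obtain ⟨c, s', h⟩ := dform_X_mul_formsBasis (F := F) i s
      rw [mul_smul_comm, h, smul_comm g, smul_comm (pderiv i p), map_zsmul, ← mul_smul,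
        coeffComp_smul_formsBasis_of_isHomogeneous l ((hp.pderiv (i := i)).mul hg), smul_ite, smul_zero]
      refine if_congr ?_ rfl rfl
      omega
    rw [coeffComp_smul_formsBasis_of_isHomogeneous _ hg, dform_mul_eq_sum, map_sum, mul_ite, mul_zero,
      dform_mul_eq_sum, Finset.sum_congr rfl fun i _ => key i]
    split_ifs <;> simp

end Wedge

/-! ### The filtration in terms of components -/

section Filtration

variable {F : Type u} [Field F] {n : ℕ}

lemma mem_degFiltration {δ : ℕ} {r : ℤ} {k : ℕ} {ω : Forms F n} :
    ω ∈ degFiltration F n δ r ((k : ℤ) - 1) ↔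
      ω ∈ extDeg (MvPolynomial (Fin n) F) (KaehlerDifferential F (MvPolynomial (Fin n) F)) k ∧
        ∀ l : ℤ, r < l + ((n : ℤ) - ((k : ℤ) - 1)) * ((δ : ℤ) - 1) → coeffComp l ω = 0 := by
  refine ⟨fun h => ?_, fun ⟨hω, h⟩ => ?_⟩
  · induction h using Submodule.span_induction with
    | mem ω h =>
      obtain ⟨m, hm, hmr⟩ := h
      refine ⟨mem_extDeg_of_mem_homForms hm, fun l hl => ?_⟩
      rw [coeffComp_of_mem_homForms l hm, if_neg]
      rintro rfl
      omega
    | zero => simp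
    | add ω η _ _ hω hη =>
      exact ⟨add_mem hω.1 hη.1, fun l hl => by rw [map_add, hω.2 l hl, hη.2 l hl, add_zero]⟩
    | smul c ω _ hω =>
      exact ⟨Submodule.smul_of_tower_mem _ c hω.1, fun l hl => by
        rw [map_smul, hω.2 l hl, smul_zero]⟩
  · obtain ⟨N, hN⟩ := exists_sum_coeffComp ω
    rw [← hN N le_rfl]
    refine sum_mem fun l _ => ?_
    by_cases hl : r < l + ((n : ℤ) - ((k : ℤ) - 1)) * ((δ : ℤ) - 1)
    · rw [h l hl]
      exact zero_mem _
    · exact Submodule.subset_span ⟨l, coeffComp_mem_homForms l hω, not_lt.1 hl⟩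

lemma degFiltration_eq_bot {k : ℤ} (hk : k < 0 ∨ n < k) (δ : ℕ) (r : ℤ) :
    degFiltration F n δ r k = ⊥ := by
  rw [degFiltration, Submodule.span_eq_bot]
  rintro ω ⟨m, hm, -⟩
  rwa [homForms_eq_bot hk, Submodule.mem_bot] at hm

/-- The parts of f of degree j < δ' would have to meet components of ω above the bound, and those
with δ' < j < δ vanish, so only two products survive. -/
lemma coeffComp_dform_mul_of_gap {f : MvPolynomial (Fin n) F} {δ δ' : ℕ}
    (hδ : f.totalDegree = δ) (hδ' : δ' < δ)
    (hgap : ∀ j : ℕ, δ' < j → j < δ → homogeneousComponent j f = 0) {m : ℤ} {ω : Forms F n}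
    (hω : ∀ i : ℤ, m + 1 - δ' < i → coeffComp i ω = 0) :
    coeffComp m (dform f * ω) =
      dform (homogeneousComponent δ f) * coeffComp (m + 1 - δ) ω +
        dform (homogeneousComponent δ' f) * coeffComp (m + 1 - δ') ω := by
  have h : dform f * ω =
      ∑ j ∈ Finset.range (δ + 1), dform (homogeneousComponent j f) * ω := by
    conv_lhs => rw [← sum_homogeneousComponent f, hδ]
    simp only [dform, map_sum, Finset.sum_mul]
  rw [h, map_sum, Finset.sum_congr rfl fun j _ =>
    coeffComp_dform_mul (homogeneousComponent_isHomogeneous j f) m ω, Finset.sum_range_succ,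
    add_comm, Finset.sum_eq_single δ']
  · intro j hj hjδ
    rcases lt_or_gt_of_ne hjδ with hlt | hlt
    · rw [hω _ (by omega), mul_zero]
    · rw [hgap j hlt (Finset.mem_range.1 hj), dform, map_zero, map_zero, zero_mul]
  · exact fun h => absurd (Finset.mem_range.2 hδ') h

end Filtration

/-! ### Passage to the spectral sequence -/

namespace IsAdmissible

variable {F : Type u} [Field F] {n t : ℕ} {G : MvPolynomial (Fin n) F}
    {g : Fin t → MvPolynomial (Fin n) F} {a d : Fin t → ℕ} {δ δ' : ℕ}
    (H : IsAdmissible G g a d δ δ')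

include H

/-- The graded form of `mem_of_mul_mem`: as dΦ and dG are homogeneous, components can be taken on
both sides, and each component of η₁ is still killed by dΦ. -/
lemma exists_coeffComp_eq {k : ℕ} (hk : k + 1 ≤ n) (l : ℤ) {ω ξ : Forms F n}
    (hω : ω ∈ extDeg (MvPolynomial (Fin n) F)
      (KaehlerDifferential F (MvPolynomial (Fin n) F)) (k + 1))
    (hξ : ξ ∈ extDeg (MvPolynomial (Fin n) F)
      (KaehlerDifferential F (MvPolynomial (Fin n) F)) (k + 1))
    (h : dform (∏ i, g i ^ a i) * ω = 0) (hG : dform G * ω = dform (∏ i, g i ^ a i) * ξ) :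
    ∃ η₁ η₂ : Forms F n, η₁ ∈ extDeg (MvPolynomial (Fin n) F)
        (KaehlerDifferential F (MvPolynomial (Fin n) F)) k ∧
      η₂ ∈ extDeg (MvPolynomial (Fin n) F)
        (KaehlerDifferential F (MvPolynomial (Fin n) F)) k ∧
      (∀ m : ℤ, dform (∏ i, g i ^ a i) * coeffComp m η₁ = 0) ∧
      coeffComp l ω = dform G * coeffComp (l + 1 - δ') η₁ +
        dform (∏ i, g i ^ a i) * coeffComp (l + 1 - δ) η₂ := by
  obtain ⟨_, ⟨η₁, hη₁, rfl⟩, _, ⟨η₂, hη₂, rfl⟩, rfl⟩ := Submodule.mem_sup.1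
    (H.mem_of_mul_mem hk (mem_kerDeg.2 ⟨hω, h⟩) ⟨ξ, hξ, hG.symm⟩)
  refine ⟨η₁, η₂, hη₁.1, hη₂, fun m => ?_, ?_⟩
  · have h := coeffComp_dform_mul H.homogeneous_prod (m + δ - 1) η₁
    rw [show dform (∏ i, g i ^ a i) * η₁ = 0 from hη₁.2, map_zero] at h
    rw [h, show m + δ - 1 + 1 - δ = m by ring]
  · rw [map_add]
    exact congrArg₂ (· + ·) (coeffComp_dform_mul H.homogeneous' l η₁)
      (coeffComp_dform_mul H.homogeneous_prod l η₂)

/-- With e = δ - δ' + 1, the components of df∧ω of degrees u and u - (δ - δ') vanish. These say that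
the top part of ω is killed by dΦ and that dG times it is a multiple of dΦ. By exactness it equals
dG∧η₁ + dΦ∧η₂, which is the top part of df∧(η₁ + η₂) because dΦ∧η₁ = 0. Subtracting lowers the
filtration of ω by one. -/
lemma approxCycles_le_approxBoundaries {f : MvPolynomial (Fin n) F}
    (hδ : f.totalDegree = δ) (hδ' : δ' < δ)
    (hgap : ∀ j : ℕ, δ' < j → j < δ → homogeneousComponent j f = 0)
    (hΦ : homogeneousComponent δ f = ∏ i, g i ^ a i) (hG : homogeneousComponent δ' f = G)
    {k : ℤ} (hk : k ≠ n) (u : ℤ) :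
    approxCycles (wedgeD f) (degFiltration F n δ) ((δ : ℤ) - δ' + 1) u k ≤
      approxBoundaries (wedgeD f) (degFiltration F n δ) ((δ : ℤ) - δ' + 1) u k := by
  rintro ω ⟨hω, hdω⟩
  rw [SetLike.mem_coe, Submodule.mem_comap, wedgeD, LinearMap.mulLeft_apply] at hdω
  by_cases hk' : k < 0 ∨ n < k
  · rw [SetLike.mem_coe, degFiltration_eq_bot hk', Submodule.mem_bot] at hω
    rw [hω]
    exact zero_mem _
  lift k to ℕ using by omega
  have hkn : k + 1 ≤ n := by omega
  have e₁ : ((k : ℕ) : ℤ) = ((k + 1 : ℕ) : ℤ) - 1 := by push_cast; ring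
  have e₂ : ((k : ℕ) : ℤ) + 1 = ((k + 2 : ℕ) : ℤ) - 1 := by push_cast; ring
  set c : ℤ := ((n : ℤ) - k) * ((δ : ℤ) - 1) with hc
  have hc₂ : ((n : ℤ) - (k + 1)) * ((δ : ℤ) - 1) = c - δ + 1 := by rw [hc]; ring
  have hc₀ : ((n : ℤ) - (k - 1)) * ((δ : ℤ) - 1) = c + δ - 1 := by rw [hc]; ring
  rw [SetLike.mem_coe, e₁, mem_degFiltration, ← e₁, ← hc] at hω
  have hdω' := hdω
  rw [e₂, mem_degFiltration, ← e₂, hc₂] at hdω'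
  obtain ⟨hωk, hω⟩ := hω
  obtain ⟨-, hdω'⟩ := hdω'
  have hf := fun {m : ℤ} {ω : Forms F n} => coeffComp_dform_mul_of_gap hδ hδ' hgap (m := m) (ω := ω)
  rw [hΦ, hG] at hf
  -- The coefficient degree of the part of ω of filtration degree exactly u.
  let l := u - c
  -- the top component of `ω` satisfies the hypotheses of the exactness statement
  have hl₁ : dform (∏ i, g i ^ a i) * coeffComp l ω = 0 := by
    have h := hf (m := l + δ - 1) (ω := ω) fun i hi => hω i (by omega)
    rw [hdω' _ (by omega), hω (l + δ - 1 + 1 - δ') (by omega), mul_zero, add_zero] at h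
    rw [h, show l + δ - 1 + 1 - δ = l by ring]
  have hl₂ : dform G * coeffComp l ω =
      dform (∏ i, g i ^ a i) * -coeffComp (l + δ' - δ) ω := by
    have h := hf (m := l + δ' - 1) (ω := ω) fun i hi => hω i (by omega)
    rw [hdω' _ (by omega), show l + δ' - 1 + 1 - δ' = l by ring,
      show l + δ' - 1 + 1 - δ = l + δ' - δ by ring] at h
    rw [mul_neg]
    exact (neg_eq_of_add_eq_zero_right h.symm).symm
  have hdeg (m : ℤ) : coeffComp m ω ∈ extDeg (MvPolynomial (Fin n) F)
      (KaehlerDifferential F (MvPolynomial (Fin n) F)) (k + 1) :=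
    mem_extDeg_of_mem_homForms (coeffComp_mem_homForms m hωk)
  obtain ⟨ζ₁, ζ₂, hζ₁, hζ₂, hζ₁0, hζ⟩ := H.exists_coeffComp_eq hkn l (hdeg l)
    (neg_mem (hdeg (l + δ' - δ))) hl₁ hl₂
  rw [coeffComp_coeffComp, if_pos rfl] at hζ
  -- The two summands have filtration degrees u + δ - δ' = u + e - 1 and u; the first explains the
  -- index in the approximate boundaries.
  let η := coeffComp (l + 1 - δ') ζ₁ + coeffComp (l + 1 - δ) ζ₂
  have hη (i : ℤ) : coeffComp i η = (if i = l + 1 - δ' then coeffComp (l + 1 - δ') ζ₁ else 0) +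
      (if i = l + 1 - δ then coeffComp (l + 1 - δ) ζ₂ else 0) := by
    rw [map_add, coeffComp_coeffComp, coeffComp_coeffComp]
  have hηk : η ∈ extDeg (MvPolynomial (Fin n) F)
      (KaehlerDifferential F (MvPolynomial (Fin n) F)) k :=
    add_mem (mem_extDeg_of_mem_homForms (coeffComp_mem_homForms _ hζ₁))
      (mem_extDeg_of_mem_homForms (coeffComp_mem_homForms _ hζ₂))
  have hdη (m : ℤ) (hm : l ≤ m) : coeffComp m (dform f * η) =
      if m = l then coeffComp l ω else 0 := by
    rw [hf (fun i hi => by rw [hη, if_neg (by omega), if_neg (by omega), add_zero]), hη, hη,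
      if_neg (show m + 1 - δ' ≠ l + 1 - δ by omega), mul_add, mul_ite, hζ₁0, mul_zero, ite_self,
      zero_add, add_zero]
    by_cases hml : m = l
    · subst hml
      rw [if_pos rfl, if_pos rfl, if_pos rfl, hζ, add_comm]
    · rw [if_neg (by omega), if_neg (by omega), if_neg hml, mul_zero, mul_zero, add_zero]
  have hdηk : dform f * η ∈ extDeg (MvPolynomial (Fin n) F)
      (KaehlerDifferential F (MvPolynomial (Fin n) F)) (k + 1) := ι_mul_mem _ hηk
  refine Submodule.mem_sup.2 ⟨ω - dform f * η, ⟨?_, ?_⟩, dform f * η, ⟨η, ⟨?_, ?_⟩, rfl⟩,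
    sub_add_cancel _ _⟩
  · rw [SetLike.mem_coe, e₁, mem_degFiltration, ← e₁, ← hc]
    refine ⟨sub_mem hωk hdηk, fun m hm => ?_⟩
    rw [map_sub, hdη m (by omega)]
    split_ifs with hml
    · rw [hml, sub_self]
    · rw [hω m (by omega), sub_zero]
  · rw [SetLike.mem_coe, Submodule.mem_comap, wedgeD, LinearMap.mulLeft_apply, mul_sub,
      dform, ι_mul_ι_mul_self, sub_zero, ← dform]
    convert hdω using 2
    ring
  · rw [SetLike.mem_coe, mem_degFiltration, hc₀]
    refine ⟨hηk, fun m hm => ?_⟩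
    rw [hη, if_neg (by omega), if_neg (by omega), add_zero]
  · rw [SetLike.mem_coe, Submodule.mem_comap, wedgeD, LinearMap.mulLeft_apply,
      sub_add_cancel, e₁, mem_degFiltration, ← e₁, ← hc]
    refine ⟨hdηk, fun m hm => ?_⟩
    rw [hdη m (by omega), if_neg (by omega)]

end IsAdmissible

lemma exists_isAdmissible {F : Type u} [Field F] {n : ℕ} {f : MvPolynomial (Fin n) F} {δ δ' : ℕ}
    (hδ : f.totalDegree = δ) (hδ' : δ' < δ) {r : ℕ} {g : Fin r → MvPolynomial (Fin n) F} {a : Fin r → ℕ}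
    (hprod : homogeneousComponent δ f = ∏ i, g i ^ a i)
    (hsmooth : ∀ S : Finset (Fin r), IsSmoothCompleteIntersection (fun i : S => g i))
    (hsmooth' : ∀ S : Finset (Fin r), (2 ≤ S.card ∨ ∃ i, S = {i} ∧ 1 < a i) →
      IsSmoothCompleteIntersection
        (fun o : Option S => o.elim (homogeneousComponent δ' f) (fun i => g i)))
    (hp : ∀ m : ℕ, m ∣ δ * δ' * ∏ i, a i → (m : F) ≠ 0) :
    ∃ d, IsAdmissible (homogeneousComponent δ' f) g a d δ δ' := by
  have hd (i : Fin r) : ∃ d, (g i).IsHomogeneous d := by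
    obtain ⟨d, -, hd⟩ := (hsmooth {i}).1 ⟨i, Finset.mem_singleton_self i⟩
    exact ⟨d, hd⟩
  choose d hd using hd
  refine ⟨d, hd, homogeneousComponent_isHomogeneous _ _,
    hprod ▸ homogeneousComponent_isHomogeneous _ _, fun h => ?_,
    hp _ (Dvd.intro _ (mul_assoc _ _ _).symm), hp _ ?_, fun i => hp _ ?_, fun S x hx hS => ?_,
    fun S h x hx hG hS => ?_⟩
  -- A monomial of f of maximal degree δ survives in the leading form, which is therefore nonzero.
  · have hf : f ≠ 0 := by
      rintro rfl
      rw [totalDegree_zero] at hδ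
      omega
    obtain ⟨s, hs, hsδ⟩ := Finset.exists_mem_eq_sup f.support
      (support_nonempty.2 hf) fun s => s.sum fun _ e => e
    have hs' : s.degree = δ := by
      rw [← hδ, totalDegree, hsδ]
      rfl
    have hc := coeff_homogeneousComponent δ f s
    rw [if_pos hs', hprod, h, coeff_zero] at hc
    exact mem_support_iff.1 hs hc.symm
  · exact Dvd.dvd.mul_right (dvd_mul_left _ _) _
  · exact Dvd.dvd.mul_left (Finset.dvd_prod_of_mem a (Finset.mem_univ i)) _
  · exact (hsmooth S).2 x hx fun i => hS i i.2
  · refine (hsmooth' S h).2 x hx fun o => ?_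
    cases o with
    | none => exact hG
    | some i => exact hS i i.2

end PolyForms

end

/-! ### The theorem -/

theorem theorem1p18
    {F : Type*} [Field F] [Finite F] (p : ℕ) [Fact p.Prime] [CharP F p]
    (n : ℕ) (f : MvPolynomial (Fin n) F) (δ δ' : ℕ)
    (hδ : f.totalDegree = δ) (hδ'_pos : 1 ≤ δ') (hδ'_lt : δ' < δ)
    (hgap : ∀ j : ℕ, δ' < j → j < δ → MvPolynomial.homogeneousComponent j f = 0)
    (r : ℕ) (g : Fin r → MvPolynomial (Fin n) F) (a : Fin r → ℕ)
    (hprod : MvPolynomial.homogeneousComponent δ f = ∏ i, g i ^ a i)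
    (hsmooth : ∀ S : Finset (Fin r),
      PolyForms.IsSmoothCompleteIntersection (fun i : S => g i))
    (hsmooth' : ∀ S : Finset (Fin r), (2 ≤ S.card ∨ ∃ i, S = {i} ∧ 1 < a i) →
      PolyForms.IsSmoothCompleteIntersection
        (fun o : Option S => o.elim (MvPolynomial.homogeneousComponent δ' f) (fun i => g i)))
    (hp : Nat.Coprime p (δ * δ' * ∏ i, a i)) :
    -- the terms of the spectral sequence vanish off total degree `n` for `e = δ - δ' + 1`
    (∀ u v : ℤ, u + v ≠ n →
      Subsingleton (PolyForms.pageTerm (PolyForms.wedgeD f)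
        (PolyForms.degFiltration F n δ) ((δ : ℤ) - δ' + 1) u v)) ∧
    -- the equivalent decomposition of the homogeneous forms killed by `df^(δ)`
    (∀ (k : ℤ) (l m : ℕ) (ω ξ : PolyForms.Forms F n), k < n →
      ω ∈ PolyForms.homForms F n k l → ξ ∈ PolyForms.homForms F n k m →
      PolyForms.dform (MvPolynomial.homogeneousComponent δ f) * ω = 0 →
      PolyForms.dform (MvPolynomial.homogeneousComponent δ' f) * ω =
        PolyForms.dform (MvPolynomial.homogeneousComponent δ f) * ξ →
      ∃ (l₁ l₂ : ℕ) (η₁ η₂ : PolyForms.Forms F n),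
        η₁ ∈ PolyForms.homForms F n (k - 1) l₁ ∧ η₂ ∈ PolyForms.homForms F n (k - 1) l₂ ∧
        PolyForms.dform (MvPolynomial.homogeneousComponent δ f) * η₁ = 0 ∧
        ω = PolyForms.dform (MvPolynomial.homogeneousComponent δ' f) * η₁ +
          PolyForms.dform (MvPolynomial.homogeneousComponent δ f) * η₂) := by
  obtain ⟨d, H⟩ := PolyForms.exists_isAdmissible hδ hδ'_lt hprod hsmooth hsmooth' fun m hm h => by
    have h1 : p ∣ m := (CharP.cast_eq_zero_iff F p m).1 h
    exact (Fact.out : p.Prime).one_lt.ne' (Nat.dvd_one.1 (hp ▸ Nat.dvd_gcd dvd_rfl (h1.trans hm)))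
  refine ⟨fun u v huv => ?_, fun k l m ω ξ hk hω hξ h0 hG => ?_⟩
  · rw [Submodule.Quotient.subsingleton_iff, Submodule.comap_subtype_eq_top]
    exact H.approxCycles_le_approxBoundaries hδ hδ'_lt hgap hprod rfl huv u
  · by_cases hk0 : k < 0
    · rw [PolyForms.homForms_eq_bot (Or.inl hk0), Submodule.mem_bot] at hω
      exact ⟨0, 0, 0, 0, zero_mem _, zero_mem _, mul_zero _, by simp [hω]⟩
    lift k to ℕ using not_lt.1 hk0
    have e : ((k : ℕ) : ℤ) = ((k + 1 : ℕ) : ℤ) - 1 := by push_cast; ring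
    rw [hprod] at h0 hG ⊢
    rw [e] at hω hξ
    obtain ⟨η₁, η₂, hη₁, hη₂, hη₁0, hη⟩ := H.exists_coeffComp_eq (by omega) l
      (PolyForms.mem_extDeg_of_mem_homForms hω) (PolyForms.mem_extDeg_of_mem_homForms hξ) h0 hG
    rw [PolyForms.coeffComp_of_mem_homForms _ hω, if_pos rfl] at hη
    -- The coefficient degrees l + 1 - δ' and l + 1 - δ may be negative; the components are then
    -- zero, so truncating the degree to a natural number is harmless.
    exact ⟨_, _, _, _, PolyForms.coeffComp_mem_homForms _ hη₁,
      PolyForms.coeffComp_mem_homForms _ hη₂, hη₁0 _, hη⟩
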